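/- Let $A\in GL_n(\mathbb R)$ be expansive (every complex eigenvalue $\lambda$ of $A$ satisfies $|\lambda|>1$), let $B=A^T$, and let $\Psi=\{\psi_1,\dots,\psi_L\}$ and $\Phi=\{\varphi_1,\dots,\varphi_L\}$ be finite families in $L^2(\mathbb R^n)$. For a full rank lattice $\Gamma\subset\mathbb R^n$, let $\mathcal A(\Psi,A,\Gamma)=\{\psi_{l,j,\gamma} : 1\le l\le L,\ j\in\mathbb Z,\ \gamma\in\Gamma\}$ with $\psi_{l,j,\gamma}(x)=|\det A|^{j/2}\psi_l(A^jx-\gamma)$, write $\mathcal A(\Psi)=\mathcal A(\Psi,A,\mathbb Z^n)$, let $\Gamma^*=\{\eta\in\mathbb R^n:\langle\eta,\gamma\rangle\in\mathbb Z\text{ for all }\gamma\in\Gamma\}$ be the dual lattice, and let $d(\Gamma)=|\det P|$ if $\Gamma=P\mathbb Z^n$, $P\in GL_n(\mathbb R)$; and similarly for $\Phi$. A countable family $(f_i)$ in a Hilbert space $\mathcal H$ is a Bessel sequence if for some constant $C<\infty$ one has $\sum_i|\langle f,f_i\rangle|^2\le C\|f\|^2$ for all $f\in\mathcal H$. Two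 Bessel sequences $(f_i)$ and $(g_i)$ with the same index set are dual frames if $f=\sum_i\langle f,g_i\rangle f_i$ (with unconditional convergence in norm) for all $f\in\mathcal H$. Fourier transforms are normalized by $\hat f(\xi)=\int_{\mathbb R^n}f(x)e^{-2\pi i\langle\xi,x\rangle}\,dx$ and extended to $L^2(\mathbb R^n)$. **Theorem.** Let $J_0\in\mathbb N_0$ and let $\Lambda\subset\mathbb R^n$ be a lattice (a discrete subgroup) containing $\mathbb Z^n$ such that $$B^{J_0+j}\mathbb Z^n\cap\Lambda^*\subset B^j\Lambda^*\qquad\text{for all }j\in\mathbb Z.$$ Suppose that for every $l=1,\dots,L$ and every $k\in\mathbb Z^n\setminus B^{J_0}\mathbb Z^n$, $$\hat\psi_l(\xi)\,\hat\varphi_l(\xi+k)=0\qquad\text{for almost every }\xi\in\mathbb R^n,$$ and that the oversampled systems $\mathcal A(d(\Lambda)^{1/2}\Psi,A,\Lambda)$ and $\mathcal A(d(\Lambda)^{1/2}\Phi,A,\Lambda)$ are Bessel sequences. If $\mathcal A(\Psi)$ and $\mathcal A(\Phi)$ are dual frames, then so are $\mathcal A(d(\Lambda)^{1/2}\Psi,A,\Lambda)$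 and $\mathcal A(d(\Lambda)^{1/2}\Phi,A,\Lambda)$. -/

import Mathlib

open MeasureTheory
open scoped FourierTransform ENNReal InnerProductSpace

namespace WaveletOversampling

noncomputable section

/-- Euclidean space `ℝⁿ`. -/
abbrev E (n : ℕ) : Type := EuclideanSpace ℝ (Fin n)

/-- The Hilbert space `L²(ℝⁿ)` of complex valued functions. -/
abbrev L2 (n : ℕ) : Type := Lp (α := E n) ℂ 2 volume

/-! ### Bessel sequences and dual frames in a Hilbert space -/

section Frames

variable {H : Type*} [NormedAddCommGroup H] [InnerProductSpace ℂ H] {ι : Type*}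

/-- `(f i)` is a Bessel sequence: for some constant `C < ∞`,
`∑ i, |⟨x, f i⟩|² ≤ C ‖x‖²` for all `x` (the series being convergent). -/
def IsBessel (f : ι → H) : Prop :=
  ∃ C : ℝ, ∀ x : H, Summable (fun i => ‖⟪f i, x⟫_ℂ‖ ^ 2) ∧
    ∑' i, ‖⟪f i, x⟫_ℂ‖ ^ 2 ≤ C * ‖x‖ ^ 2

/-- `(f i)` and `(g i)` are dual frames: both are Bessel sequences, and
`x = ∑ i, ⟨x, g i⟩ f i` for all `x`. Mathlib's inner product is conjugate-linear in its first
argument, so that the coefficient `⟨x, g i⟩`, linear in `x`, reads `⟪g i, x⟫_ℂ`. -/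
def IsDualFrames (f g : ι → H) : Prop :=
  IsBessel f ∧ IsBessel g ∧ ∀ x : H, HasSum (fun i => ⟪g i, x⟫_ℂ • f i) x

end Frames

/-! ### Lattices -/

variable {n : ℕ}

/-- The integer lattice `ℤⁿ ⊆ ℝⁿ`, the `ℤ`-span of the standard basis. -/
def integerLattice (n : ℕ) : Submodule ℤ (E n) :=
  Submodule.span ℤ (Set.range (EuclideanSpace.basisFun (Fin n) ℝ).toBasis)

/-- The dual lattice `Λ* = {η : ⟨η, x⟩ ∈ ℤ for all x ∈ Λ}`. -/
def dualLattice (Λ : Submodule ℤ (E n)) : Submodule ℤ (E n) :=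
  LinearMap.BilinForm.dualSubmodule (innerₗ (E n)) Λ

theorem mem_dualLattice {Λ : Submodule ℤ (E n)} {η : E n} :
    η ∈ dualLattice Λ ↔ ∀ x ∈ Λ, ∃ m : ℤ, (m : ℝ) = ⟪η, x⟫_ℝ := by
  simp [dualLattice, LinearMap.BilinForm.mem_dualSubmodule, Submodule.mem_one]

/-! ### Dilations and wavelet systems -/

/-- The matrix `A` is expansive: every complex eigenvalue has modulus greater than `1`. -/
def IsExpansive (A : GL (Fin n) ℝ) : Prop :=
  ∀ z : ℂ, Module.End.HasEigenvalue
    (Matrix.toLin' ((A : Matrix (Fin n) (Fin n) ℝ).map (algebraMap ℝ ℂ))) z → 1 < ‖z‖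

/-- The set `Bʲ S = {Bʲ x : x ∈ S}`, where `B = Aᵀ`. -/
def transposePowImage (A : GL (Fin n) ℝ) (j : ℤ) (S : Set (E n)) : Set (E n) :=
  Matrix.toEuclideanLin ((A : Matrix (Fin n) (Fin n) ℝ).transpose ^ j) '' S

theorem memLp_comp_gl (A : GL (Fin n) ℝ) {f : E n → ℂ} (hf : MemLp f 2 volume) :
    MemLp (fun x => f (Matrix.toEuclideanLin (A : Matrix (Fin n) (Fin n) ℝ) x)) 2 volume := by
  set T : E n →ₗ[ℝ] E n := Matrix.toEuclideanLin (A : Matrix (Fin n) (Fin n) ℝ) with hT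
  have hdet : LinearMap.det T ≠ 0 := by
    have h : LinearMap.det T = (A : Matrix (Fin n) (Fin n) ℝ).det := by
      rw [hT, Matrix.toEuclideanLin_eq_toLin_orthonormal, LinearMap.det_toLin]
    rw [h]
    exact ((Matrix.isUnit_iff_isUnit_det _).1 A.isUnit).ne_zero
  have hmap := Measure.map_linearMap_addHaar_eq_smul_addHaar (volume : Measure (E n)) hdet
  refine MemLp.comp_of_map (f := T) ?_ T.continuous_of_finiteDimensional.aemeasurable
  rw [hmap]
  exact hf.smul_measure ENNReal.ofReal_ne_top

/-- The dilation operator `D_A f (x) = |det A|^{1/2} f (A x)` on `L²(ℝⁿ)`. -/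
def dilation (A : GL (Fin n) ℝ) (f : L2 n) : L2 n :=
  ((Real.sqrt |(A : Matrix (Fin n) (Fin n) ℝ).det| : ℝ) : ℂ) •
    (memLp_comp_gl A (Lp.memLp f)).toLp
      (fun x => f (Matrix.toEuclideanLin (A : Matrix (Fin n) (Fin n) ℝ) x))

/-- The translation operator `T_y f (x) = f (x - y)` on `L²(ℝⁿ)`. -/
def translation (y : E n) (f : L2 n) : L2 n :=
  ((Lp.memLp f).comp_measurePreserving (measurePreserving_sub_right volume y)).toLp
    (fun x => f (x - y))

/-- The wavelet system `{D_{Aʲ} T_γ ψ_l : 1 ≤ l ≤ L, j ∈ ℤ, γ ∈ Γ}`, as a family indexed by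
`(l, j, γ)`. -/
def waveletSystem {L : ℕ} (Ψ : Fin L → L2 n) (A : GL (Fin n) ℝ) (Γ : Submodule ℤ (E n)) :
    Fin L × ℤ × Γ → L2 n :=
  fun i => dilation (A ^ i.2.1) (translation (i.2.2 : E n) (Ψ i.1))

/-- The `Λ`-oversampled wavelet system, generated by `d(Λ)^{1/2} ψ_l` with translations along `Λ`.
Here `d(Λ)`, the covolume of `Λ`, is `|det P|` if `Λ = P ℤⁿ`. -/
def oversampledSystem {L : ℕ} (Ψ : Fin L → L2 n) (A : GL (Fin n) ℝ) (Λ : Submodule ℤ (E n)) :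
    Fin L × ℤ × Λ → L2 n :=
  waveletSystem (fun l => ((Real.sqrt (ZLattice.covolume Λ) : ℝ) : ℂ) • Ψ l) A Λ

end

end WaveletOversampling

/-!
Write `B = Aᵀ` and, for `f, g ∈ L²(ℝⁿ)`, let `w(x)` be the frame sum
`∑ ⟨T_x f, φ_{l,j,γ}⟩ ⟨ψ_{l,j,γ}, T_x g⟩`. The proof is a translational averaging argument: the given
systems are dual frames exactly when `w` is the constant `⟨f, g⟩` for all `f, g`, and oversampling
acts on the frequencies of `w`.

Since the systems are Bessel, it suffices to treat `f, g` in a set with trivial orthogonal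
complement (`hasSum_of_total`). This set is chosen as the functions whose Fourier transform is
bounded and supported in a small ball that avoids the origin (`smallBandSet`). For such functions,
Parseval's identity for periodizations (`hasSum_integerLattice_parseval`) shows that the part of
`w` at the scale `j` is a trigonometric series with the frequencies `Bʲ k`, `k ∈ ℤⁿ`, and with the
correlation coefficients `c_{l,j}(k)` of `corr` (`hasSum_inner_mul_inner`).

These coefficients are absolutely summable over all `l, j, k` (`tsum_tsum_enorm_corr_ne_top`). At
the scales `j ≥ 0` the Bessel property controls the only coefficients that remain; at the scales
`j ≤ 0` the number of coefficients is bounded by a packing argument, and the bands `B⁻ʲ K` have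
bounded overlap as `A` is expansive. A Gaussian mean then determines the coefficients
(`tsum_fiber_eq_of_hasSum_const`): as `w` is constant, the `c_{l,j}(k)` with `Bʲ k = α` sum to `0`
for `α ≠ 0`, and to `⟨f, g⟩` for `α = 0`.

Summation over `Λ` instead of `ℤⁿ` is, after normalization by `d(Λ) = 1 / [Λ : ℤⁿ]`, an average over
the cosets of `ℤⁿ`, and so deletes the coefficients with `k ∉ Λ*` (`tsum_inner_mul_inner_eq`). If
some `k ∈ Λ*` has `Bʲ k = α`, the support condition on `ψ̂_l φ̂_l` and the lattice condition
(`mem_dualLattice_of_frequency_eq`) force every nonzero coefficient over `α` to survive. Hence the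
sum over each `α` either persists or disappears entirely, and the total remains `⟨f, g⟩`
(`tsum_indicator_eq_of_fiber`).
-/

namespace WaveletOversampling

noncomputable section

open Filter Topology ComplexConjugate

variable {n : ℕ}

/-! ### Invertible matrices acting on Euclidean space -/

/-- The action of `GLₙ(ℝ)` on `ℝⁿ`, as a homomorphism to the group of continuous linear
automorphisms. -/
def glEquiv : GL (Fin n) ℝ →* (E n ≃L[ℝ] E n) :=
  (ContinuousLinearEquiv.unitsEquiv ℝ (E n)).toMonoidHom.comp
    (Units.map (Matrix.toEuclideanCLM (𝕜 := ℝ) (n := Fin n) : _ →* (E n →L[ℝ] E n)))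

theorem glEquiv_apply (G : GL (Fin n) ℝ) (x : E n) :
    glEquiv G x = Matrix.toEuclideanLin (G : Matrix (Fin n) (Fin n) ℝ) x := rfl

theorem glEquiv_mul_apply (G H : GL (Fin n) ℝ) (x : E n) :
    glEquiv (G * H) x = glEquiv G (glEquiv H x) := by
  rw [map_mul]; rfl

theorem glEquiv_inv_apply_self (G : GL (Fin n) ℝ) (x : E n) :
    glEquiv G⁻¹ (glEquiv G x) = x := by
  rw [← glEquiv_mul_apply, inv_mul_cancel, map_one]; rfl

theorem glEquiv_apply_inv_self (G : GL (Fin n) ℝ) (x : E n) :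
    glEquiv G (glEquiv G⁻¹ x) = x := by
  rw [← glEquiv_mul_apply, mul_inv_cancel, map_one]; rfl

/-- The transpose of an invertible matrix, as an invertible matrix. -/
def glTranspose (G : GL (Fin n) ℝ) : GL (Fin n) ℝ where
  val := (G : Matrix (Fin n) (Fin n) ℝ).transpose
  inv := ((G⁻¹ : GL (Fin n) ℝ) : Matrix (Fin n) (Fin n) ℝ).transpose
  val_inv := by rw [← Matrix.transpose_mul, ← Units.val_mul, inv_mul_cancel]; simp
  inv_val := by rw [← Matrix.transpose_mul, ← Units.val_mul, mul_inv_cancel]; simp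

@[simp]
theorem coe_glTranspose (G : GL (Fin n) ℝ) :
    (glTranspose G : Matrix (Fin n) (Fin n) ℝ) = (G : Matrix (Fin n) (Fin n) ℝ).transpose := rfl

theorem glTranspose_zpow (G : GL (Fin n) ℝ) (j : ℤ) : glTranspose (G ^ j) = glTranspose G ^ j := by
  apply Units.ext
  rw [coe_glTranspose, Matrix.coe_units_zpow, Matrix.transpose_zpow, Matrix.coe_units_zpow,
    coe_glTranspose]

theorem glTranspose_inv (G : GL (Fin n) ℝ) : glTranspose G⁻¹ = (glTranspose G)⁻¹ := by
  simpa using glTranspose_zpow G (-1)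

theorem inner_glEquiv (G : GL (Fin n) ℝ) (x y : E n) :
    ⟪glEquiv G x, y⟫_ℝ = ⟪x, glEquiv (glTranspose G) y⟫_ℝ := by
  rw [glEquiv_apply, glEquiv_apply, EuclideanSpace.inner_eq_star_dotProduct,
    EuclideanSpace.inner_eq_star_dotProduct, Matrix.ofLp_toLpLin,
    Matrix.ofLp_toLpLin, coe_glTranspose]
  simp [Matrix.dotProduct_mulVec, Matrix.mulVec_transpose]

theorem transposePowImage_eq (A : GL (Fin n) ℝ) (j : ℤ) (S : Set (E n)) :
    transposePowImage A j S = glEquiv (glTranspose A ^ j) '' S := by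
  have : ((A : Matrix (Fin n) (Fin n) ℝ).transpose ^ j) =
      ((glTranspose A ^ j : GL (Fin n) ℝ) : Matrix (Fin n) (Fin n) ℝ) := by
    rw [Matrix.coe_units_zpow, coe_glTranspose]
  rw [transposePowImage, this]; rfl

/-- The modulus of the determinant. -/
def absDet (G : GL (Fin n) ℝ) : ℝ := |(G : Matrix (Fin n) (Fin n) ℝ).det|

theorem absDet_pos (G : GL (Fin n) ℝ) : 0 < absDet G :=
  abs_pos.2 ((Matrix.isUnit_iff_isUnit_det _).1 G.isUnit).ne_zero

theorem absDet_inv (G : GL (Fin n) ℝ) : absDet G⁻¹ = (absDet G)⁻¹ := by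
  simp [absDet, Matrix.det_nonsing_inv, abs_inv]

theorem absDet_glTranspose (G : GL (Fin n) ℝ) : absDet (glTranspose G) = absDet G := by
  simp [absDet]

theorem map_glEquiv_volume (G : GL (Fin n) ℝ) :
    Measure.map (glEquiv G) (volume : Measure (E n)) =
      ENNReal.ofReal (absDet G)⁻¹ • (volume : Measure (E n)) := by
  set T : E n →ₗ[ℝ] E n := Matrix.toEuclideanLin (G : Matrix (Fin n) (Fin n) ℝ) with hT
  have h : LinearMap.det T = (G : Matrix (Fin n) (Fin n) ℝ).det := by
    rw [hT, Matrix.toEuclideanLin_eq_toLin_orthonormal, LinearMap.det_toLin]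
  have hdet : LinearMap.det T ≠ 0 := by
    rw [h]
    exact ((Matrix.isUnit_iff_isUnit_det _).1 G.isUnit).ne_zero
  have := Measure.map_linearMap_addHaar_eq_smul_addHaar (volume : Measure (E n)) hdet
  rw [h, abs_inv] at this
  exact this

theorem measurableEmbedding_glEquiv (G : GL (Fin n) ℝ) : MeasurableEmbedding (glEquiv G) :=
  (glEquiv G).toHomeomorph.measurableEmbedding

theorem quasiMeasurePreserving_glEquiv (G : GL (Fin n) ℝ) :
    Measure.QuasiMeasurePreserving (glEquiv G) (volume : Measure (E n)) volume :=
  ⟨(glEquiv G).continuous.measurable, by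
    rw [map_glEquiv_volume]; exact Measure.smul_absolutelyContinuous⟩

theorem integral_comp_glEquiv {F : Type*} [NormedAddCommGroup F] [NormedSpace ℝ F]
    (G : GL (Fin n) ℝ) (f : E n → F) :
    ∫ x, f (glEquiv G x) = (absDet G)⁻¹ • ∫ x, f x := by
  rw [← (measurableEmbedding_glEquiv G).integral_map, map_glEquiv_volume, integral_smul_measure,
    ENNReal.toReal_ofReal (inv_nonneg.2 (absDet_pos G).le)]

theorem volume_image_glEquiv (G : GL (Fin n) ℝ) (s : Set (E n)) :
    volume (glEquiv G '' s) = ENNReal.ofReal (absDet G) * volume s := by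
  have h := congrArg (fun μ : Measure (E n) => μ (glEquiv G '' s)) (map_glEquiv_volume G)
  simp only [Measure.smul_apply, smul_eq_mul] at h
  rw [(measurableEmbedding_glEquiv G).map_apply,
    Set.preimage_image_eq _ (glEquiv G).injective] at h
  rw [h, ← mul_assoc, ← ENNReal.ofReal_mul (absDet_pos G).le, mul_inv_cancel₀ (absDet_pos G).ne',
    ENNReal.ofReal_one, one_mul]

/-! ### Expansive matrices -/

/-- In a complex Banach algebra, the powers of an element of spectral radius less than `1` tend
to `0`. This is Gelfand's formula. -/
theorem tendsto_pow_of_spectralRadius_lt_one {R : Type*} [NormedRing R] [NormedAlgebra ℂ R]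
    [CompleteSpace R] {a : R} (ha : spectralRadius ℂ a < 1) :
    Tendsto (fun k : ℕ => a ^ k) atTop (𝓝 0) := by
  obtain ⟨r, hr, hr1⟩ := ENNReal.lt_iff_exists_nnreal_btwn.1 ha
  have h := (spectrum.pow_nnnorm_pow_one_div_tendsto_nhds_spectralRadius a).eventually_lt_const hr
  have hr1' : r < 1 := by exact_mod_cast hr1
  rw [tendsto_zero_iff_norm_tendsto_zero]
  refine squeeze_zero' (Eventually.of_forall fun _ => norm_nonneg _) ?_
    (tendsto_pow_atTop_nhds_zero_of_lt_one r.coe_nonneg (by exact_mod_cast hr1'))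
  filter_upwards [h, eventually_gt_atTop 0] with k hk hk0
  have h1 : ((‖a ^ k‖₊ : ℝ≥0∞) ^ (1 / k : ℝ)) ^ (k : ℝ) ≤ (r : ℝ≥0∞) ^ (k : ℝ) :=
    ENNReal.rpow_le_rpow hk.le (by positivity)
  rw [← ENNReal.rpow_mul, one_div_mul_cancel (by positivity), ENNReal.rpow_one,
    ENNReal.rpow_natCast] at h1
  exact_mod_cast h1

attribute [local instance] Matrix.linftyOpNormedRing Matrix.linftyOpNormedAlgebra in
theorem tendsto_complex_inv_pow {M : Matrix (Fin n) (Fin n) ℂ} (hM : IsUnit M)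
    (h : ∀ z : ℂ, Module.End.HasEigenvalue (Matrix.toLin' M) z → 1 < ‖z‖) (a b : Fin n) :
    Tendsto (fun k : ℕ => (M⁻¹ ^ k) a b) atTop (𝓝 0) := by
  have : Nonempty (Fin n) := ⟨a⟩
  have hs : spectralRadius ℂ M⁻¹ < 1 := by
    refine spectrum.spectralRadius_lt_of_forall_lt (r := 1) _ fun z hz => ?_
    obtain ⟨u, rfl⟩ := hM
    rw [← Matrix.coe_units_inv] at hz
    have hz0 : z ≠ 0 := spectrum.ne_zero_of_mem_of_unit hz
    have h2 : z⁻¹ ∈ spectrum ℂ (u : Matrix (Fin n) (Fin n) ℂ) := by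
      have := (spectrum.inv_mem_iff (r := Units.mk0 z hz0) (a := u⁻¹)).1 (by simpa using hz)
      simpa using this
    have h3 := h z⁻¹ (by
      rw [Module.End.hasEigenvalue_iff_mem_spectrum, Matrix.spectrum_toLin']; exact h2)
    rw [norm_inv] at h3
    have h4 : ‖z‖ < 1 := (one_lt_inv₀ (norm_pos_iff.2 hz0)).1 h3
    exact h4
  have h5 := tendsto_pow_of_spectralRadius_lt_one hs
  exact tendsto_pi_nhds.1 (tendsto_pi_nhds.1 h5 a) b

/-- If `A` is expansive and `B = Aᵀ`, then `B⁻ʲ → 0` in operator norm. -/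
theorem IsExpansive.tendsto_transpose_neg_pow {A : GL (Fin n) ℝ} (hA : IsExpansive A) :
    Tendsto (fun k : ℕ => ‖(glEquiv (glTranspose A ^ (-(k : ℤ))) : E n →L[ℝ] E n)‖)
      atTop (𝓝 0) := by
  set M := (A : Matrix (Fin n) (Fin n) ℝ).map (algebraMap ℝ ℂ) with hMdef
  have hM : IsUnit M :=
    A.isUnit.map (algebraMap ℝ ℂ).mapMatrix
  have hinv : M⁻¹ = (((A⁻¹ : GL (Fin n) ℝ) : Matrix (Fin n) (Fin n) ℝ)).map (algebraMap ℝ ℂ) := by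
    refine Matrix.inv_eq_right_inv ?_
    rw [hMdef, ← Matrix.map_mul, ← Units.val_mul, mul_inv_cancel]
    simp
  have hent : ∀ a b, Tendsto (fun k : ℕ =>
      (((A⁻¹ : GL (Fin n) ℝ) : Matrix (Fin n) (Fin n) ℝ) ^ k) a b) atTop (𝓝 0) := by
    intro a b
    have := tendsto_complex_inv_pow hM hA a b
    rw [hinv] at this
    have h2 := (Complex.continuous_re.tendsto _).comp this
    simp only [← Matrix.map_pow] at h2
    simpa [Function.comp_def] using h2
  have hB : Tendsto (fun k : ℕ => ((glTranspose A ^ (-(k : ℤ)) : GL (Fin n) ℝ) :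
      Matrix (Fin n) (Fin n) ℝ)) atTop (𝓝 0) := by
    refine tendsto_pi_nhds.2 fun a => tendsto_pi_nhds.2 fun b => ?_
    have : ∀ k : ℕ, ((glTranspose A ^ (-(k : ℤ)) : GL (Fin n) ℝ) :
        Matrix (Fin n) (Fin n) ℝ) a b =
        (((A⁻¹ : GL (Fin n) ℝ) : Matrix (Fin n) (Fin n) ℝ) ^ k) b a := by
      intro k
      rw [← glTranspose_zpow, coe_glTranspose, Matrix.transpose_apply, zpow_neg, zpow_natCast,
        ← inv_pow, Units.val_pow_eq_pow_val]
    simp only [this]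
    exact hent b a
  have hc : Continuous (Matrix.toEuclideanCLM (𝕜 := ℝ) (n := Fin n)) :=
    LinearMap.continuous_of_finiteDimensional
      ((Matrix.toEuclideanCLM (𝕜 := ℝ) (n := Fin n)).toAlgEquiv.toLinearMap)
  have := ((hc.tendsto 0).comp hB).norm
  rw [map_zero, norm_zero] at this
  exact this

/-- A common bound for the operator norms of `B⁻ʲ`, `j ≥ 0`. -/
theorem IsExpansive.exists_bound {A : GL (Fin n) ℝ} (hA : IsExpansive A) :
    ∃ C : ℝ, 0 < C ∧ ∀ j : ℤ, j ≤ 0 → ∀ x : E n, ‖glEquiv (glTranspose A ^ j) x‖ ≤ C * ‖x‖ := by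
  obtain ⟨C, hC⟩ := hA.tendsto_transpose_neg_pow.bddAbove_range
  refine ⟨max C 1, by positivity, fun j hj x => ?_⟩
  obtain ⟨k, rfl⟩ := Int.exists_eq_neg_ofNat hj
  refine ((glEquiv (glTranspose A ^ (-(k : ℤ))) : E n →L[ℝ] E n).le_opNorm x).trans ?_
  gcongr
  exact (hC ⟨k, rfl⟩).trans (le_max_left _ _)

/-- A compact set that avoids the origin contains a bounded number of the points `Bʲ ξ`, `j ∈ ℤ`,
uniformly in `ξ`. -/
theorem IsExpansive.exists_card_le {A : GL (Fin n) ℝ} (hA : IsExpansive A) {a b : ℝ} (ha : 0 < a) :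
    ∃ m : ℕ, ∀ (ξ : E n) (s : Finset ℤ),
      (∀ j ∈ s, a ≤ ‖glEquiv (glTranspose A ^ j) ξ‖ ∧ ‖glEquiv (glTranspose A ^ j) ξ‖ ≤ b) →
        s.card ≤ m := by
  obtain ⟨m, hm⟩ := eventually_atTop.1 (hA.tendsto_transpose_neg_pow.eventually_lt_const
    (show (0 : ℝ) < a / (|b| + 1) by positivity))
  refine ⟨m, fun ξ s hs => ?_⟩
  rcases s.eq_empty_or_nonempty with rfl | hne
  · simp
  -- all indices lie within `m` of the largest one, as `B⁻ᵏ`, `k ≥ m`, leaves the annulus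
  have hsub : s ⊆ Finset.Ioc (s.max' hne - m) (s.max' hne) := by
    intro i hi
    rw [Finset.mem_Ioc]
    refine ⟨?_, s.le_max' i hi⟩
    by_contra! hlt
    obtain ⟨k, hk⟩ : ∃ k : ℕ, s.max' hne - i = k :=
      Int.eq_ofNat_of_zero_le (by linarith [s.le_max' i hi])
    have hmk : m ≤ k := by omega
    have h1 := hm k hmk
    have h2 := hs i hi
    have h3 := hs _ (s.max'_mem hne)
    have h4 : glEquiv (glTranspose A ^ i) ξ =
        glEquiv (glTranspose A ^ (-(k : ℤ))) (glEquiv (glTranspose A ^ (s.max' hne)) ξ) := by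
      rw [← glEquiv_mul_apply, ← zpow_add]; congr 3; omega
    have h5 : ‖glEquiv (glTranspose A ^ i) ξ‖ ≤ (a / (|b| + 1)) * |b| := by
      rw [h4]
      refine ((glEquiv (glTranspose A ^ (-(k : ℤ))) : E n →L[ℝ] E n).le_opNorm _).trans ?_
      gcongr
      exact h3.2.trans (le_abs_self b)
    have h6 : (a / (|b| + 1)) * |b| < a := by
      rw [div_mul_eq_mul_div, div_lt_iff₀ (by positivity)]
      nlinarith [abs_nonneg b]
    linarith
  have := Finset.card_le_card hsub
  simpa using this

/-- The character `t ↦ exp (2πit)` of the real line, with complex values. -/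
def ech (t : ℝ) : ℂ := Complex.exp (2 * Real.pi * t * Complex.I)

theorem fourierChar_smul (t : ℝ) (z : ℂ) : 𝐞 t • z = ech t * z := by
  rw [Circle.smul_def, Real.fourierChar_apply, ech, smul_eq_mul]
  push_cast
  rfl

theorem ech_add (s t : ℝ) : ech (s + t) = ech s * ech t := by
  rw [ech, ech, ech, ← Complex.exp_add]
  congr 1
  push_cast
  ring

theorem ech_neg (t : ℝ) : ech (-t) = conj (ech t) := by
  rw [ech, ech, ← Complex.exp_conj]
  congr 1
  simp only [map_mul, Complex.conj_ofReal, Complex.conj_I, Complex.conj_ofNat]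
  push_cast
  ring

@[simp]
theorem ech_zero : ech 0 = 1 := by simp [ech]

@[simp]
theorem norm_ech (t : ℝ) : ‖ech t‖ = 1 := by
  have : ech t = Complex.exp ((2 * Real.pi * t : ℝ) * Complex.I) := by rw [ech]; push_cast; rfl
  rw [this, Complex.norm_exp_ofReal_mul_I]

theorem ech_mul_conj (t : ℝ) : ech t * conj (ech t) = 1 := by
  rw [← ech_neg, ← ech_add, add_neg_cancel, ech_zero]

@[fun_prop]
theorem continuous_ech : Continuous ech := by unfold ech; fun_prop

theorem ech_eq_one_of_int {t : ℝ} (h : ∃ m : ℤ, (m : ℝ) = t) : ech t = 1 := by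
  obtain ⟨m, rfl⟩ := h
  rw [ech, Complex.exp_eq_one_iff]
  exact ⟨m, by push_cast; ring⟩

/-! ### Translations, dilations and the Fourier transform on `L²` -/

theorem coeFn_translation (y : E n) (f : L2 n) : translation y f =ᵐ[volume] fun x => f (x - y) :=
  MemLp.coeFn_toLp _

theorem coeFn_dilation (G : GL (Fin n) ℝ) (f : L2 n) :
    dilation G f =ᵐ[volume] fun x => (Real.sqrt (absDet G) : ℂ) * f (glEquiv G x) := by
  filter_upwards [Lp.coeFn_smul ((Real.sqrt (absDet G) : ℝ) : ℂ)
    ((memLp_comp_gl G (Lp.memLp f)).toLp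
      (fun x => f (Matrix.toEuclideanLin (G : Matrix (Fin n) (Fin n) ℝ) x))),
    (memLp_comp_gl G (Lp.memLp f)).coeFn_toLp] with x hx hx2
  rw [dilation]
  refine hx.trans ?_
  rw [Pi.smul_apply, hx2]; rfl

theorem quasiMeasurePreserving_sub (y : E n) :
    Measure.QuasiMeasurePreserving (fun x : E n => x - y) volume volume :=
  (measurePreserving_sub_right volume y).quasiMeasurePreserving

theorem quasiMeasurePreserving_add (y : E n) :
    Measure.QuasiMeasurePreserving (fun x : E n => x + y) volume volume :=
  (measurePreserving_add_right volume y).quasiMeasurePreserving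

/-- Translation by `y` as a linear isometry of `L²(ℝⁿ)`. -/
def translationₗᵢ (y : E n) : L2 n →ₗᵢ[ℂ] L2 n :=
  LinearMap.isometryOfInner
    { toFun := translation y
      map_add' := fun f g => by
        refine Lp.ext ?_
        filter_upwards [coeFn_translation y (f + g), coeFn_translation y f, coeFn_translation y g,
          Lp.coeFn_add (translation y f) (translation y g),
          (quasiMeasurePreserving_sub y).ae (Lp.coeFn_add f g)] with x h1 h2 h3 h4 h5
        rw [h1, h4, Pi.add_apply, h2, h3, h5, Pi.add_apply]
      map_smul' := fun c f => by
        refine Lp.ext ?_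
        filter_upwards [coeFn_translation y (c • f), coeFn_translation y f,
          Lp.coeFn_smul c (translation y f),
          (quasiMeasurePreserving_sub y).ae (Lp.coeFn_smul c f)] with x h1 h2 h4 h5
        rw [h1, RingHom.id_apply, h4, Pi.smul_apply, h2, h5, Pi.smul_apply] }
    fun f g => by
      simp only [LinearMap.coe_mk, AddHom.coe_mk, L2.inner_def]
      rw [← integral_sub_right_eq_self (fun x => ⟪f x, g x⟫_ℂ) y]
      refine integral_congr_ae ?_
      filter_upwards [coeFn_translation y f, coeFn_translation y g] with x h1 h2
      rw [h1, h2]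

@[simp]
theorem translationₗᵢ_apply (y : E n) (f : L2 n) : translationₗᵢ y f = translation y f := rfl

/-- Dilation by `G` as a linear isometry of `L²(ℝⁿ)`. -/
def dilationₗᵢ (G : GL (Fin n) ℝ) : L2 n →ₗᵢ[ℂ] L2 n :=
  LinearMap.isometryOfInner
    { toFun := dilation G
      map_add' := fun f g => by
        refine Lp.ext ?_
        filter_upwards [coeFn_dilation G (f + g), coeFn_dilation G f, coeFn_dilation G g,
          Lp.coeFn_add (dilation G f) (dilation G g),
          (quasiMeasurePreserving_glEquiv G).ae (Lp.coeFn_add f g)] with x h1 h2 h3 h4 h5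
        rw [h1, h4, Pi.add_apply, h2, h3, h5, Pi.add_apply, mul_add]
      map_smul' := fun c f => by
        refine Lp.ext ?_
        filter_upwards [coeFn_dilation G (c • f), coeFn_dilation G f,
          Lp.coeFn_smul c (dilation G f),
          (quasiMeasurePreserving_glEquiv G).ae (Lp.coeFn_smul c f)] with x h1 h2 h4 h5
        rw [h1, RingHom.id_apply, h4, Pi.smul_apply, h2, h5, Pi.smul_apply, smul_eq_mul,
          smul_eq_mul, mul_left_comm] }
    fun f g => by
      simp only [LinearMap.coe_mk, AddHom.coe_mk, L2.inner_def]
      have h : ∀ᵐ x : E n, ⟪dilation G f x, dilation G g x⟫_ℂ =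
          absDet G • ⟪f (glEquiv G x), g (glEquiv G x)⟫_ℂ := by
        filter_upwards [coeFn_dilation G f, coeFn_dilation G g] with x h1 h2
        rw [h1, h2]
        simp only [RCLike.inner_apply, map_mul, Complex.conj_ofReal, Complex.real_smul]
        have : (Real.sqrt (absDet G) : ℂ) * (Real.sqrt (absDet G) : ℂ) = (absDet G : ℂ) := by
          rw [← Complex.ofReal_mul, Real.mul_self_sqrt (absDet_pos G).le]
        rw [← this]; ring
      rw [integral_congr_ae h, integral_smul, integral_comp_glEquiv G (fun x => ⟪f x, g x⟫_ℂ),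
        smul_smul, mul_inv_cancel₀ (absDet_pos G).ne', one_smul]

@[simp]
theorem dilationₗᵢ_apply (G : GL (Fin n) ℝ) (f : L2 n) : dilationₗᵢ G f = dilation G f := rfl

theorem memLp_modulation (y : E n) (f : L2 n) :
    MemLp (fun ξ : E n => ech (-⟪y, ξ⟫_ℝ) * f ξ) 2 volume := by
  have hc : Continuous fun ξ : E n => ech (-⟪y, ξ⟫_ℝ) := by fun_prop
  refine (Lp.memLp f).congr_norm (hc.aestronglyMeasurable.mul (Lp.aestronglyMeasurable f)) ?_
  filter_upwards with ξ
  rw [norm_mul, norm_ech, one_mul]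

/-- Modulation, the multiplication by the character `ξ ↦ exp (-2πi⟨y, ξ⟩)`, on `L²(ℝⁿ)`. -/
def modulation (y : E n) (f : L2 n) : L2 n := (memLp_modulation y f).toLp _

theorem coeFn_modulation (y : E n) (f : L2 n) :
    modulation y f =ᵐ[volume] fun ξ => ech (-⟪y, ξ⟫_ℝ) * f ξ :=
  MemLp.coeFn_toLp _

/-- Modulation as a linear isometry of `L²(ℝⁿ)`. -/
def modulationₗᵢ (y : E n) : L2 n →ₗᵢ[ℂ] L2 n :=
  LinearMap.isometryOfInner
    { toFun := modulation y
      map_add' := fun f g => by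
        refine Lp.ext ?_
        filter_upwards [coeFn_modulation y (f + g), coeFn_modulation y f, coeFn_modulation y g,
          Lp.coeFn_add (modulation y f) (modulation y g), Lp.coeFn_add f g] with x h1 h2 h3 h4 h5
        rw [h1, h4, Pi.add_apply, h2, h3, h5, Pi.add_apply, mul_add]
      map_smul' := fun c f => by
        refine Lp.ext ?_
        filter_upwards [coeFn_modulation y (c • f), coeFn_modulation y f,
          Lp.coeFn_smul c (modulation y f), Lp.coeFn_smul c f] with x h1 h2 h4 h5
        rw [h1, RingHom.id_apply, h4, Pi.smul_apply, h2, h5, Pi.smul_apply, smul_eq_mul,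
          smul_eq_mul, mul_left_comm] }
    fun f g => by
      simp only [LinearMap.coe_mk, AddHom.coe_mk, L2.inner_def]
      refine integral_congr_ae ?_
      filter_upwards [coeFn_modulation y f, coeFn_modulation y g] with x h1 h2
      rw [h1, h2]
      simp only [RCLike.inner_apply, map_mul]
      linear_combination (g x * conj (f x)) * ech_mul_conj (-⟪y, x⟫_ℝ)

/-- Two continuous maps of `L²(ℝⁿ)` that agree on Schwartz functions are equal. -/
theorem eq_of_eq_on_schwartz {S T : L2 n → L2 n} (hS : Continuous S) (hT : Continuous T)
    (h : ∀ f : SchwartzMap (E n) ℂ, S (f.toLp 2) = T (f.toLp 2)) (f : L2 n) : S f = T f := by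
  have hd := SchwartzMap.denseRange_toLpCLM (E := E n) (F := ℂ) (p := 2) (μ := volume)
    ENNReal.ofNat_ne_top
  exact congrFun (hd.equalizer hS hT (funext fun g => h g)) f

theorem fourier_translation (y : E n) (f : L2 n) :
    (𝓕 (translation y f) : L2 n) =ᵐ[volume]
      fun ξ => ech (-⟪y, ξ⟫_ℝ) * (𝓕 f : L2 n) ξ := by
  have key : (𝓕 (translation y f) : L2 n) = modulation y (𝓕 f : L2 n) := by
    refine eq_of_eq_on_schwartz (S := fun f => (𝓕 (translation y f) : L2 n))
      (T := fun f => modulation y (𝓕 f : L2 n))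
      ((Lp.fourierTransformₗᵢ (E n) ℂ).continuous.comp (translationₗᵢ y).continuous)
      ((modulationₗᵢ y).continuous.comp (Lp.fourierTransformₗᵢ (E n) ℂ).continuous) ?_ f
    intro f
    have h1 : translation y (f.toLp 2) = (SchwartzMap.compSubConstCLM ℂ y f).toLp 2 := by
      refine Lp.ext ?_
      filter_upwards [coeFn_translation y (f.toLp 2),
        (quasiMeasurePreserving_sub y).ae (f.coeFn_toLp 2 volume),
        (SchwartzMap.compSubConstCLM ℂ y f).coeFn_toLp 2 volume] with x h1 h2 h3
      rw [h1, h2, h3, SchwartzMap.compSubConstCLM_apply]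
    simp only [h1, SchwartzMap.toLp_fourier_eq]
    refine Lp.ext ?_
    filter_upwards [coeFn_modulation y ((𝓕 f).toLp 2), (𝓕 f).coeFn_toLp 2 volume,
      (𝓕 (SchwartzMap.compSubConstCLM ℂ y f)).coeFn_toLp 2 volume] with ξ h1 h2 h3
    rw [h1, h2, h3, SchwartzMap.fourier_coe, SchwartzMap.fourier_coe, Real.fourier_eq,
      Real.fourier_eq, ← integral_add_right_eq_self (μ := (volume : Measure (E n))) _ y,
      ← integral_const_mul]
    refine integral_congr_ae (Eventually.of_forall fun v => ?_)
    simp only [SchwartzMap.compSubConstCLM_apply, add_sub_cancel_right, inner_add_left, neg_add,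
      fourierChar_smul, ech_add]
    ring
  rw [key]
  exact coeFn_modulation y _

theorem fourier_dilation (G : GL (Fin n) ℝ) (f : L2 n) :
    (𝓕 (dilation G f) : L2 n) =ᵐ[volume]
      fun ξ => (Real.sqrt (absDet (glTranspose G)⁻¹) : ℂ) *
        (𝓕 f : L2 n) (glEquiv (glTranspose G)⁻¹ ξ) := by
  have key : (𝓕 (dilation G f) : L2 n) = dilation (glTranspose G)⁻¹ (𝓕 f : L2 n) := by
    refine eq_of_eq_on_schwartz (S := fun f => (𝓕 (dilation G f) : L2 n))
      (T := fun f => dilation (glTranspose G)⁻¹ (𝓕 f : L2 n))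
      ((Lp.fourierTransformₗᵢ (E n) ℂ).continuous.comp (dilationₗᵢ G).continuous)
      ((dilationₗᵢ _).continuous.comp (Lp.fourierTransformₗᵢ (E n) ℂ).continuous) ?_ f
    intro f
    have h1 : dilation G (f.toLp 2) = (Real.sqrt (absDet G) : ℂ) •
        (SchwartzMap.compCLMOfContinuousLinearEquiv ℂ (glEquiv G) f).toLp 2 volume := by
      refine Lp.ext ?_
      filter_upwards [coeFn_dilation G (f.toLp 2),
        (quasiMeasurePreserving_glEquiv G).ae (f.coeFn_toLp 2 volume),
        (SchwartzMap.compCLMOfContinuousLinearEquiv ℂ (glEquiv G) f).coeFn_toLp 2 volume,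
        Lp.coeFn_smul (Real.sqrt (absDet G) : ℂ)
        ((SchwartzMap.compCLMOfContinuousLinearEquiv ℂ (glEquiv G) f).toLp 2 volume)]
        with x h1 h2 h3 h4
      rw [h1, h2, h4, Pi.smul_apply, h3, SchwartzMap.compCLMOfContinuousLinearEquiv_apply,
        smul_eq_mul, Function.comp_apply]
    simp only [h1, FourierTransform.fourier_smul, SchwartzMap.toLp_fourier_eq]
    refine Lp.ext ?_
    filter_upwards [coeFn_dilation (glTranspose G)⁻¹ ((𝓕 f).toLp 2),
      (quasiMeasurePreserving_glEquiv (glTranspose G)⁻¹).ae ((𝓕 f).coeFn_toLp 2 volume),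
      (𝓕 (SchwartzMap.compCLMOfContinuousLinearEquiv ℂ (glEquiv G) f)).coeFn_toLp 2 volume,
      Lp.coeFn_smul (Real.sqrt (absDet G) : ℂ)
        ((𝓕 (SchwartzMap.compCLMOfContinuousLinearEquiv ℂ (glEquiv G) f)).toLp 2 volume)]
      with ξ h1 h2 h3 h4
    rw [h1, h2, h4, Pi.smul_apply, h3, SchwartzMap.fourier_coe, SchwartzMap.fourier_coe,
      Real.fourier_eq, Real.fourier_eq]
    have h5 := integral_comp_glEquiv G
      (fun v => 𝐞 (-⟪v, glEquiv (glTranspose G)⁻¹ ξ⟫_ℝ) • f v)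
    simp only [inner_glEquiv, glEquiv_apply_inv_self] at h5
    simp only [SchwartzMap.compCLMOfContinuousLinearEquiv_apply, Function.comp_apply]
    rw [h5, absDet_inv, absDet_glTranspose, smul_eq_mul, Complex.real_smul, ← mul_assoc]
    congr 1
    rw [← Complex.ofReal_mul]
    congr 1
    rw [Real.sqrt_inv]
    have hp := Real.sqrt_pos.2 (absDet_pos G)
    have hp' := absDet_pos G
    field_simp
    rw [Real.sq_sqrt hp'.le]
  rw [key]
  exact coeFn_dilation _ _

theorem translation_translation (x y : E n) (f : L2 n) :
    translation x (translation y f) = translation (x + y) f := by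
  refine Lp.ext ?_
  filter_upwards [coeFn_translation x (translation y f), coeFn_translation (x + y) f,
    (quasiMeasurePreserving_sub x).ae (coeFn_translation y f)] with z h1 h2 h3
  rw [h1, h2, h3, sub_sub]

theorem translation_zero (f : L2 n) : translation 0 f = f := by
  refine Lp.ext ?_
  filter_upwards [coeFn_translation 0 f] with z h1
  rw [h1, sub_zero]

theorem dilation_translation (G : GL (Fin n) ℝ) (y : E n) (f : L2 n) :
    dilation G (translation (glEquiv G y) f) = translation y (dilation G f) := by
  refine Lp.ext ?_
  filter_upwards [coeFn_dilation G (translation (glEquiv G y) f),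
    (quasiMeasurePreserving_glEquiv G).ae (coeFn_translation (glEquiv G y) f),
    coeFn_translation y (dilation G f),
    (quasiMeasurePreserving_sub y).ae (coeFn_dilation G f)] with z h1 h2 h3 h4
  rw [h1, h2, h3, h4, map_sub]

theorem dilation_dilation_inv (G : GL (Fin n) ℝ) (f : L2 n) :
    dilation G (dilation G⁻¹ f) = f := by
  refine Lp.ext ?_
  filter_upwards [coeFn_dilation G (dilation G⁻¹ f),
    (quasiMeasurePreserving_glEquiv G).ae (coeFn_dilation G⁻¹ f)] with z h1 h2
  rw [h1, h2, glEquiv_inv_apply_self, ← mul_assoc, ← Complex.ofReal_mul,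
    ← Real.sqrt_mul (absDet_pos G).le, absDet_inv, mul_inv_cancel₀ (absDet_pos G).ne']
  simp

theorem inner_translation_translation (y : E n) (f g : L2 n) :
    ⟪translation y f, translation y g⟫_ℂ = ⟪f, g⟫_ℂ :=
  (translationₗᵢ y).inner_map_map f g

/-- A dilation is moved from one side of an inner product to the other as its inverse. -/
theorem inner_dilation_left (G : GL (Fin n) ℝ) (f g : L2 n) :
    ⟪dilation G f, g⟫_ℂ = ⟪f, dilation G⁻¹ g⟫_ℂ := by
  conv_lhs => rw [← dilation_dilation_inv G g]
  exact (dilationₗᵢ G).inner_map_map f _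

theorem inner_translation_left (y : E n) (f g : L2 n) :
    ⟪translation y f, g⟫_ℂ = ⟪f, translation (-y) g⟫_ℂ := by
  rw [← inner_translation_translation y f, translation_translation, add_neg_cancel,
    translation_zero]

/-- Coefficients of translates of `f` in a wavelet system, reduced to scale `0`. -/
theorem inner_dilation_translation (G : GL (Fin n) ℝ) (γ x : E n) (φ f : L2 n) :
    ⟪dilation G (translation γ φ), translation x f⟫_ℂ =
      ⟪translation γ φ, translation (glEquiv G x) (dilation G⁻¹ f)⟫_ℂ := by
  rw [inner_dilation_left]
  conv_lhs => rw [← glEquiv_inv_apply_self G x]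
  rw [← dilation_translation, glEquiv_inv_apply_self]

/-- The coefficient of a translate of `f` against a translate of `φ`, on the Fourier side. -/
theorem inner_translation_eq_integral (γ y : E n) (φ f : L2 n) :
    ⟪translation γ φ, translation y f⟫_ℂ =
      ∫ ξ : E n, (ech (-⟪y, ξ⟫_ℝ) * ((𝓕 f : L2 n) ξ * conj ((𝓕 φ : L2 n) ξ))) *
        ech ⟪γ, ξ⟫_ℝ := by
  rw [← Lp.inner_fourier_eq, L2.inner_def]
  refine integral_congr_ae ?_
  filter_upwards [fourier_translation γ φ, fourier_translation y f] with ξ h1 h2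
  rw [h1, h2]
  simp only [RCLike.inner_apply, map_mul, ← ech_neg, neg_neg]
  ring

/-! ### The integer lattice and Parseval's identity for periodizations -/

instance : DiscreteTopology (integerLattice n) := by unfold integerLattice; infer_instance

instance : IsZLattice ℝ (integerLattice n) := by unfold integerLattice; infer_instance

instance : Countable (integerLattice n) := by unfold integerLattice; infer_instance

theorem mem_integerLattice {x : E n} : x ∈ integerLattice n ↔ ∀ i, ∃ m : ℤ, (m : ℝ) = x i := by
  rw [integerLattice, Module.Basis.mem_span_iff_repr_mem]
  simp

/-- Integer vectors, as elements of the integer lattice. -/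
def integerLatticeEquiv : (Fin n → ℤ) ≃ integerLattice n where
  toFun m := ⟨WithLp.toLp 2 fun i => (m i : ℝ), mem_integerLattice.2 fun i => ⟨m i, rfl⟩⟩
  invFun x := fun i => (mem_integerLattice.1 x.2 i).choose
  left_inv m := funext fun i => by
    have := (mem_integerLattice.1 (⟨WithLp.toLp 2 fun i => (m i : ℝ),
      mem_integerLattice.2 fun i => ⟨m i, rfl⟩⟩ : integerLattice n).2 i).choose_spec
    exact Int.cast_injective (α := ℝ) this
  right_inv x := by
    ext i
    exact (mem_integerLattice.1 x.2 i).choose_spec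

@[simp]
theorem integerLatticeEquiv_apply (m : Fin n → ℤ) (i : Fin n) :
    (integerLatticeEquiv m : E n) i = m i := rfl

theorem inner_mem_int {x y : E n} (hx : x ∈ integerLattice n) (hy : y ∈ integerLattice n) :
    ∃ m : ℤ, (m : ℝ) = ⟪x, y⟫_ℝ := by
  choose a ha using mem_integerLattice.1 hx
  choose b hb using mem_integerLattice.1 hy
  refine ⟨∑ i, b i * a i, ?_⟩
  simp [PiLp.inner_apply, ← ha, ← hb]

theorem one_le_norm_of_mem_integerLattice {x : E n} (hx : x ∈ integerLattice n) (h0 : x ≠ 0) :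
    1 ≤ ‖x‖ := by
  choose a ha using mem_integerLattice.1 hx
  obtain ⟨i, hi⟩ : ∃ i, x i ≠ 0 := by
    by_contra! h
    exact h0 (by ext i; simpa using h i)
  have h1 : 1 ≤ ‖x i‖ := by
    rw [← ha i] at hi ⊢
    rw [Real.norm_eq_abs]
    have : a i ≠ 0 := Int.cast_ne_zero.1 hi
    exact_mod_cast Int.one_le_abs this
  exact h1.trans (PiLp.norm_apply_le x i)

theorem finite_integerLattice_norm_le (R : ℝ) :
    {k : integerLattice n | ‖(k : E n)‖ ≤ R}.Finite := by
  have hcl : IsClosed (integerLattice n : Set (E n)) :=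
    have : DiscreteTopology (integerLattice n).toAddSubgroup :=
      inferInstanceAs (DiscreteTopology (integerLattice n))
    AddSubgroup.isClosed_of_discrete (H := (integerLattice n).toAddSubgroup)
  have hd : IsDiscrete (integerLattice n : Set (E n)) := ⟨inferInstanceAs
    (DiscreteTopology (integerLattice n))⟩
  have h := Metric.finite_isBounded_inter_isClosed hd
    (Metric.isBounded_closedBall (x := (0 : E n)) (r := R)) hcl
  refine Set.Finite.of_finite_image (h.subset ?_) Subtype.val_injective.injOn
  rintro _ ⟨k, hk, rfl⟩
  exact ⟨by simpa using hk, k.2⟩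

/-- The half-open unit cube, a fundamental domain of the integer lattice. -/
def unitCube (n : ℕ) : Set (E n) :=
  ZSpan.fundamentalDomain (EuclideanSpace.basisFun (Fin n) ℝ).toBasis

theorem isAddFundamentalDomain_unitCube :
    IsAddFundamentalDomain (integerLattice n) (unitCube n) volume :=
  ZSpan.isAddFundamentalDomain (EuclideanSpace.basisFun (Fin n) ℝ).toBasis volume

instance : VAddInvariantMeasure (integerLattice n) (E n) volume :=
  inferInstanceAs (VAddInvariantMeasure (integerLattice n).toAddSubgroup (E n) volume)

instance : MeasurableConstVAdd (integerLattice n) (E n) :=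
  inferInstanceAs (MeasurableConstVAdd (integerLattice n).toAddSubgroup (E n))

theorem mem_unitCube {x : E n} : x ∈ unitCube n ↔ ∀ i, x i ∈ Set.Ico (0 : ℝ) 1 := by
  simp [unitCube, ZSpan.mem_fundamentalDomain]

/-- The periodization `∑ₖ F (ξ + k)` over the integer lattice. -/
def periodize (F : E n → ℂ) (ξ : E n) : ℂ := ∑' k : integerLattice n, F (ξ + k)

theorem periodize_add (F : E n → ℂ) (ξ : E n) (k : integerLattice n) :
    periodize F (ξ + k) = periodize F ξ := by
  unfold periodize
  rw [← (Equiv.addLeft k).tsum_eq (fun k' : integerLattice n => F (ξ + k'))]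
  simp [add_assoc]

/-- Unfolding: the integral of a periodization over the unit cube is the integral over `ℝⁿ`. -/
theorem integral_unitCube_periodize {H : E n → ℂ} (hH : Integrable H) :
    ∫ ξ in unitCube n, periodize H ξ = ∫ ξ, H ξ := by
  have hfd := isAddFundamentalDomain_unitCube (n := n)
  have hv : ∀ (k : integerLattice n) (x : E n), k +ᵥ x = x + k := fun k x => by
    rw [Submodule.vadd_def, vadd_eq_add, add_comm]
  rw [hfd.integral_eq_tsum'' H hH]
  unfold periodize
  rw [integral_tsum]
  · simp only [hv]
  · exact fun k => ((hH.comp_add_right (k : E n)).aestronglyMeasurable).restrict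
  · have := hfd.lintegral_eq_tsum'' (fun x => ‖H x‖ₑ)
    simp only [hv] at this
    rw [← this]
    exact hH.2.ne

/-- On a bounded set, the periodization of a function with bounded support is a finite sum, over a
fixed set of lattice vectors. -/
theorem periodize_eq_sum {F : E n → ℂ} {R R' : ℝ} (hF : ∀ ξ, F ξ ≠ 0 → ‖ξ‖ ≤ R) {ξ : E n}
    (hξ : ‖ξ‖ ≤ R') :
    periodize F ξ =
      ∑ k ∈ (finite_integerLattice_norm_le (n := n) (R + R')).toFinset, F (ξ + k) := by
  refine tsum_eq_sum fun k hk => ?_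
  contrapose! hk
  rw [Set.Finite.mem_toFinset, Set.mem_ofPred_eq]
  have h1 := hF _ hk
  calc ‖(k : E n)‖ = ‖(ξ + k) - ξ‖ := by rw [add_sub_cancel_left]
    _ ≤ ‖ξ + k‖ + ‖ξ‖ := norm_sub_le _ _
    _ ≤ R + R' := add_le_add h1 hξ

theorem exists_norm_le_of_mem_unitCube : ∃ R : ℝ, ∀ ξ ∈ unitCube n, ‖ξ‖ ≤ R :=
  (ZSpan.fundamentalDomain_isBounded (EuclideanSpace.basisFun (Fin n) ℝ).toBasis).exists_norm_le

theorem measurableSet_unitCube : MeasurableSet (unitCube n) :=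
  ZSpan.fundamentalDomain_measurableSet _

theorem memLp_periodize {F : E n → ℂ} (hF : MemLp F 2 volume) {R : ℝ}
    (hR : ∀ ξ, F ξ ≠ 0 → ‖ξ‖ ≤ R) : MemLp (periodize F) 2 (volume.restrict (unitCube n)) := by
  obtain ⟨R', hR'⟩ := exists_norm_le_of_mem_unitCube (n := n)
  have h : MemLp (fun ξ => ∑ k ∈ (finite_integerLattice_norm_le (n := n) (R + R')).toFinset,
      F (ξ + k)) 2 (volume.restrict (unitCube n)) :=
    memLp_finsetSum _ fun k _ =>
      (hF.comp_measurePreserving (measurePreserving_add_right volume (k : E n))).restrict _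
  refine (memLp_congr_ae ?_).1 h
  filter_upwards [ae_restrict_mem measurableSet_unitCube] with ξ hξ
  exact (periodize_eq_sum hR (hR' ξ hξ)).symm

section Torus

local instance : MeasureSpace UnitAddCircle := ⟨AddCircle.haarAddCircle⟩

local instance : IsProbabilityMeasure (volume : Measure UnitAddCircle) :=
  inferInstanceAs (IsProbabilityMeasure AddCircle.haarAddCircle)

/-- The section of the projection `ℝⁿ → ℝⁿ/ℤⁿ` with values in `(0, 1]ⁿ`. -/
def torusSection (t : UnitAddTorus (Fin n)) : E n :=
  WithLp.toLp 2 (UnitAddTorus.measurableEquivPiIoc (fun _ : Fin n => (0 : ℝ)) t : Fin n → ℝ)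

theorem coe_torusSection (t : UnitAddTorus (Fin n)) (i : Fin n) :
    (torusSection t i : UnitAddCircle) = t i :=
  AddCircle.coe_equivIoc

theorem unitCube_ae_eq : unitCube n =ᵐ[volume]
    (WithLp.ofLp ⁻¹' {x : Fin n → ℝ | ∀ i, x i ∈ Set.Ioc (0 : ℝ) (0 + 1)} : Set (E n)) := by
  have h1 : ({x : Fin n → ℝ | ∀ i, x i ∈ Set.Ioc (0 : ℝ) (0 + 1)} : Set (Fin n → ℝ)) =ᵐ[volume]
      ({x : Fin n → ℝ | ∀ i, x i ∈ Set.Ico (0 : ℝ) 1} : Set (Fin n → ℝ)) := by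
    have h2 := (Measure.univ_pi_Ioc_ae_eq_Icc (μ := fun _ : Fin n => (volume : Measure ℝ))
      (f := fun _ => 0) (g := fun _ => 1)).trans
      (Measure.univ_pi_Ico_ae_eq_Icc (μ := fun _ : Fin n => (volume : Measure ℝ))
      (f := fun _ => 0) (g := fun _ => 1)).symm
    have e1 : ({x : Fin n → ℝ | ∀ i, x i ∈ Set.Ioc (0 : ℝ) (0 + 1)} : Set (Fin n → ℝ)) =
      Set.univ.pi fun _ => Set.Ioc (0 : ℝ) 1 := by ext; simp
    have e2 : ({x : Fin n → ℝ | ∀ i, x i ∈ Set.Ico (0 : ℝ) 1} : Set (Fin n → ℝ)) =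
      Set.univ.pi fun _ => Set.Ico (0 : ℝ) 1 := by ext; simp
    rw [e1, e2]
    exact h2
  have h3 := (PiLp.volume_preserving_ofLp (Fin n)).quasiMeasurePreserving.preimage_ae_eq h1
  refine EventuallyEq.trans (Eq.eventuallyEq ?_) h3.symm
  ext x
  exact mem_unitCube

theorem measurePreserving_torusSection :
    MeasurePreserving (torusSection (n := n)) volume (volume.restrict (unitCube n)) := by
  have hS : MeasurableSet {x : Fin n → ℝ | ∀ i, x i ∈ Set.Ioc (0 : ℝ) (0 + 1)} :=
    MeasurableSet.univ_pi' fun _ => measurableSet_Ioc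
  rw [Measure.restrict_congr_set unitCube_ae_eq]
  have h1 := UnitAddTorus.measurePreserving_equivPiIoc (fun _ : Fin n => (0 : ℝ))
  have h2 := (measurePreserving_subtype_coe (μa := (volume : Measure (Fin n → ℝ))) hS).comp h1
  have h3 := (PiLp.volume_preserving_toLp (Fin n)).restrict_preimage
    (s := (WithLp.ofLp ⁻¹' {x : Fin n → ℝ | ∀ i, x i ∈ Set.Ioc (0 : ℝ) (0 + 1)} : Set (E n)))
    ((PiLp.volume_preserving_ofLp (Fin n)).measurable hS)
  exact h3.comp h2

theorem mFourier_eq_ech (m : Fin n → ℤ) (t : UnitAddTorus (Fin n)) :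
    UnitAddTorus.mFourier m t = ech ⟪(integerLatticeEquiv m : E n), torusSection t⟫_ℝ := by
  simp only [UnitAddTorus.mFourier, ContinuousMap.coe_mk]
  rw [ech, PiLp.inner_apply]
  have : ∀ i, fourier (m i) (t i) =
      Complex.exp (2 * Real.pi * (m i * torusSection t i : ℝ) * Complex.I) := by
    intro i
    rw [← coe_torusSection t i, fourier_coe_apply]
    congr 1
    push_cast
    ring
  rw [Finset.prod_congr rfl fun i _ => this i, ← Complex.exp_sum]
  congr 1
  rw [← Finset.sum_mul, ← Finset.mul_sum]
  push_cast
  congr 2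
  refine Finset.sum_congr rfl fun i _ => ?_
  simp [mul_comm]

/-- Parseval's identity on the unit cube. -/
theorem hasSum_unitCube_parseval {p q : E n → ℂ} (hp : MemLp p 2 (volume.restrict (unitCube n)))
    (hq : MemLp q 2 (volume.restrict (unitCube n))) :
    HasSum (fun k : integerLattice n =>
      (∫ ξ in unitCube n, p ξ * ech ⟪(k : E n), ξ⟫_ℝ) *
        conj (∫ ξ in unitCube n, q ξ * ech ⟪(k : E n), ξ⟫_ℝ))
      (∫ ξ in unitCube n, p ξ * conj (q ξ)) := by
  have hs := measurePreserving_torusSection (n := n)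
  have hP := hp.comp_measurePreserving hs
  have hQ := hq.comp_measurePreserving hs
  have key := UnitAddTorus.hasSum_prod_mFourierCoeff (hQ.toLp _) (hP.toLp _)
  have hint : ∀ h : E n → ℂ, AEStronglyMeasurable h (volume.restrict (unitCube n)) →
      ∫ t, h (torusSection t) = ∫ ξ in unitCube n, h ξ := by
    intro h hm
    rw [← hs.map_eq] at hm ⊢
    exact (integral_map hs.aemeasurable hm).symm
  have hcoef : ∀ (r : E n → ℂ) (hr : MemLp r 2 (volume.restrict (unitCube n)))
      (m : Fin n → ℤ), UnitAddTorus.mFourierCoeff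
        ((hr.comp_measurePreserving hs).toLp _ : UnitAddTorus (Fin n) → ℂ) m =
      ∫ ξ in unitCube n, r ξ * ech (-⟪(integerLatticeEquiv m : E n), ξ⟫_ℝ) := by
    intro r hr m
    have hc : Continuous fun ξ : E n => ech (-⟪(integerLatticeEquiv m : E n), ξ⟫_ℝ) := by fun_prop
    rw [UnitAddTorus.mFourierCoeff, ← hint (fun ξ => r ξ * _)
      (hr.aestronglyMeasurable.mul hc.aestronglyMeasurable)]
    refine integral_congr_ae ?_
    filter_upwards [(hr.comp_measurePreserving hs).coeFn_toLp] with t ht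
    rw [ht, smul_eq_mul, mul_comm, UnitAddTorus.mFourier_neg, mFourier_eq_ech,
      ech_neg, Function.comp_apply]
  have hval : ∫ t, conj ((hQ.toLp _ : UnitAddTorus (Fin n) → ℂ) t) *
      (hP.toLp _ : UnitAddTorus (Fin n) → ℂ) t = ∫ ξ in unitCube n, p ξ * conj (q ξ) := by
    rw [← hint (fun ξ => p ξ * _) (hp.aestronglyMeasurable.mul
      (Complex.continuous_conj.comp_aestronglyMeasurable hq.aestronglyMeasurable))]
    refine integral_congr_ae ?_
    filter_upwards [hP.coeFn_toLp, hQ.coeFn_toLp] with t h1 h2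
    rw [h1, h2, mul_comm]
    rfl
  rw [hval] at key
  have key2 := ((Equiv.neg (Fin n → ℤ)).trans integerLatticeEquiv).symm.hasSum_iff.2 key
  refine key2.congr_fun fun k => ?_
  obtain ⟨m, rfl⟩ := ((Equiv.neg (Fin n → ℤ)).trans integerLatticeEquiv).surjective k
  have hneg : ∀ ξ : E n, -⟪(integerLatticeEquiv m : E n), ξ⟫_ℝ =
      ⟪(integerLatticeEquiv (-m) : E n), ξ⟫_ℝ := by
    intro ξ
    rw [← inner_neg_left]
    congr 1
    ext i
    simp
  simp only [Function.comp_apply, Equiv.symm_apply_apply]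
  rw [hcoef q hq, hcoef p hp, mul_comm]
  simp only [hneg]
  rfl

end Torus

/-- Parseval's identity for the Fourier coefficients `∫ F(ξ) exp (2πi⟨γ, ξ⟩) dξ`, `γ ∈ ℤⁿ`, of
functions with bounded support. -/
theorem hasSum_integerLattice_parseval {F G : E n → ℂ} (hF : MemLp F 2 volume)
    (hG : MemLp G 2 volume) {R : ℝ} (hFR : ∀ ξ, F ξ ≠ 0 → ‖ξ‖ ≤ R)
    (hGR : ∀ ξ, G ξ ≠ 0 → ‖ξ‖ ≤ R) :
    HasSum (fun γ : integerLattice n => (∫ ξ, F ξ * ech ⟪(γ : E n), ξ⟫_ℝ) *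
        conj (∫ ξ, G ξ * ech ⟪(γ : E n), ξ⟫_ℝ))
      (∑' k : integerLattice n, ∫ ξ, F (ξ + k) * conj (G ξ)) := by
  have hbs : ∀ {H : E n → ℂ}, MemLp H 2 volume → (∀ ξ, H ξ ≠ 0 → ‖ξ‖ ≤ R) →
      Integrable H := by
    intro H hH hHR
    have h1 : IntegrableOn H (Metric.closedBall 0 R) :=
      have : IsFiniteMeasure (volume.restrict (Metric.closedBall (0 : E n) R)) :=
        isFiniteMeasure_restrict.2 measure_closedBall_lt_top.ne
      (hH.restrict _).integrable (by norm_num)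
    refine (integrableOn_iff_integrable_of_support_subset fun ξ hξ => ?_).1 h1
    simpa using hHR ξ hξ
  have hcoef : ∀ {H : E n → ℂ}, MemLp H 2 volume → (∀ ξ, H ξ ≠ 0 → ‖ξ‖ ≤ R) →
      ∀ γ : integerLattice n, ∫ ξ in unitCube n, periodize H ξ * ech ⟪(γ : E n), ξ⟫_ℝ =
        ∫ ξ, H ξ * ech ⟪(γ : E n), ξ⟫_ℝ := by
    intro H hH hHR γ
    rw [← integral_unitCube_periodize]
    · congr 1
      ext ξ
      unfold periodize
      rw [← tsum_mul_right]
      refine tsum_congr fun k => ?_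
      beta_reduce
      rw [inner_add_right, ech_add, ech_eq_one_of_int (inner_mem_int γ.2 k.2), mul_one]
    · refine (hbs hH hHR).congr' ((hbs hH hHR).aestronglyMeasurable.mul
        (Continuous.aestronglyMeasurable (by fun_prop))) ?_
      filter_upwards with ξ
      rw [norm_mul, norm_ech, mul_one]
  have key := hasSum_unitCube_parseval (memLp_periodize hF hFR) (memLp_periodize hG hGR)
  simp only [hcoef hF hFR, hcoef hG hGR] at key
  convert key using 1
  -- as `periodize G` is periodic, `∫` of `periodize F * conj (periodize G)` over the cube unfolds to
  -- `∫` of `periodize F * conj G` over `ℝⁿ`, in which only finitely many terms occur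
  set s := (finite_integerLattice_norm_le (n := n) (R + R)).toFinset with hs
  have hz : ∀ k : integerLattice n, k ∉ s → ∀ ξ, F (ξ + k) * conj (G ξ) = 0 := by
    intro k hk ξ
    by_contra h
    have h1 := hFR _ (left_ne_zero_of_mul h)
    have h2 := hGR ξ (fun h0 => h (by rw [h0, map_zero, mul_zero]))
    refine hk ?_
    rw [hs, Set.Finite.mem_toFinset, Set.mem_ofPred_eq]
    calc ‖(k : E n)‖ = ‖(ξ + k) - ξ‖ := by rw [add_sub_cancel_left]
      _ ≤ ‖ξ + k‖ + ‖ξ‖ := norm_sub_le _ _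
      _ ≤ R + R := add_le_add h1 h2
  have hpw : ∀ ξ, periodize F ξ * conj (G ξ) = ∑ k ∈ s, F (ξ + k) * conj (G ξ) := by
    intro ξ
    unfold periodize
    rw [← tsum_mul_right]
    exact tsum_eq_sum fun k hk => hz k hk ξ
  have hint : ∀ k : integerLattice n, Integrable fun ξ => F (ξ + k) * conj (G ξ) := fun k =>
    (hF.comp_measurePreserving (measurePreserving_add_right volume (k : E n))).integrable_mul
      hG.star
  have hint2 : Integrable fun ξ => periodize F ξ * conj (G ξ) := by
    simp only [hpw]
    exact integrable_finsetSum _ fun k _ => hint k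
  have hper : ∀ ξ, periodize F ξ * conj (periodize G ξ) =
      periodize (fun ξ => periodize F ξ * conj (G ξ)) ξ := by
    intro ξ
    rw [periodize.eq_def (fun ξ => periodize F ξ * conj (G ξ)), periodize.eq_def G,
      Complex.conj_tsum, ← tsum_mul_left]
    refine tsum_congr fun k => ?_
    rw [periodize_add]
  simp only [hper]
  rw [integral_unitCube_periodize hint2]
  simp only [hpw]
  rw [integral_finsetSum _ fun k _ => hint k]
  refine tsum_eq_sum fun k hk => ?_
  simp only [hz k hk, integral_zero]

/-! ### Correlation coefficients -/

/-- The `k`-th correlation coefficient `∫ F(ξ + k) conj G(ξ) dξ` of `F = f̂ conj φ̂` and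
`G = ĝ conj ψ̂`. -/
def corr (f g φ ψ : L2 n) (k : E n) : ℂ :=
  ∫ ξ : E n, ((𝓕 f : L2 n) (ξ + k) * conj ((𝓕 φ : L2 n) (ξ + k))) *
    conj ((𝓕 g : L2 n) ξ * conj ((𝓕 ψ : L2 n) ξ))

/-- The Fourier transform of `f` is essentially bounded, and supported in a bounded set. -/
def HasBoundedBand (f : L2 n) : Prop :=
  ∃ M R : ℝ, ∀ᵐ ξ : E n, ‖(𝓕 f : L2 n) ξ‖ ≤ (Metric.closedBall 0 R).indicator (fun _ => M) ξ

/-- The product `exp (-2πi⟨y, ·⟩) f̂ conj φ̂` has a square integrable representative that vanishes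
everywhere outside a ball. -/
theorem HasBoundedBand.exists_truncation {f : L2 n} (hf : HasBoundedBand f) (φ : L2 n) (y : E n) :
    ∃ (F : E n → ℂ) (R : ℝ), MemLp F 2 volume ∧ (∀ ξ, F ξ ≠ 0 → ‖ξ‖ ≤ R) ∧
      ∀ᵐ ξ, F ξ = ech (-⟪y, ξ⟫_ℝ) * ((𝓕 f : L2 n) ξ * conj ((𝓕 φ : L2 n) ξ)) := by
  obtain ⟨M, R, h⟩ := hf
  refine ⟨(Metric.closedBall 0 R).indicator fun ξ =>
    ech (-⟪y, ξ⟫_ℝ) * ((𝓕 f : L2 n) ξ * conj ((𝓕 φ : L2 n) ξ)), R, ?_, ?_, ?_⟩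
  · have hc : Continuous fun ξ : E n => ech (-⟪y, ξ⟫_ℝ) := by fun_prop
    refine ((Lp.memLp (𝓕 φ : L2 n)).const_mul ((max M 0 : ℝ) : ℂ)).of_le
      ((hc.aestronglyMeasurable.mul ((Lp.aestronglyMeasurable _).mul
        (Complex.continuous_conj.comp_aestronglyMeasurable
          (Lp.aestronglyMeasurable _)))).indicator Metric.isClosed_closedBall.measurableSet) ?_
    filter_upwards [h] with ξ hξ
    refine (norm_indicator_le_norm_self _ _).trans ?_
    rw [norm_mul, norm_ech, one_mul, norm_mul, norm_mul, RCLike.norm_conj, Complex.norm_real,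
      Real.norm_of_nonneg (le_max_right _ _)]
    gcongr
    refine hξ.trans ?_
    by_cases hm : ξ ∈ Metric.closedBall 0 R <;> simp [hm]
  · intro ξ hξ
    simpa using Set.mem_of_indicator_ne_zero hξ
  · filter_upwards [h] with ξ hξ
    by_cases hm : ξ ∈ Metric.closedBall 0 R
    · rw [Set.indicator_of_mem hm]
    · rw [Set.indicator_of_notMem hm] at hξ ⊢
      rw [norm_le_zero_iff.1 hξ]
      simp

/-- At scale `0`, the contribution of the integer translates to the frame operator, as a function
of a translation parameter `y`, is a trigonometric series with the correlation coefficients. -/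
theorem hasSum_inner_mul_inner {f g : L2 n} (hf : HasBoundedBand f) (hg : HasBoundedBand g)
    (φ ψ : L2 n) (y : E n) :
    HasSum (fun γ : integerLattice n => ⟪translation (γ : E n) φ, translation y f⟫_ℂ *
        conj ⟪translation (γ : E n) ψ, translation y g⟫_ℂ)
      (∑' k : integerLattice n, ech (-⟪y, (k : E n)⟫_ℝ) * corr f g φ ψ k) := by
  obtain ⟨F, R, hF, hFR, hFe⟩ := hf.exists_truncation φ y
  obtain ⟨G, R', hG, hGR, hGe⟩ := hg.exists_truncation ψ y
  have key := hasSum_integerLattice_parseval hF hG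
    (fun ξ h => (hFR ξ h).trans (le_max_left R R')) (fun ξ h => (hGR ξ h).trans (le_max_right R R'))
  convert key using 1
  · funext γ
    rw [inner_translation_eq_integral, inner_translation_eq_integral]
    congr 1
    · refine integral_congr_ae ?_
      filter_upwards [hFe] with ξ h
      rw [h]
    · congr 1
      refine integral_congr_ae ?_
      filter_upwards [hGe] with ξ h
      rw [h]
  · refine tsum_congr fun k => ?_
    rw [corr, ← integral_const_mul]
    refine integral_congr_ae ?_
    filter_upwards [hGe, (quasiMeasurePreserving_add (k : E n)).ae hFe] with ξ h1 h2
    rw [h1, h2, inner_add_right, neg_add, ech_add, map_mul (starRingEnd ℂ) (ech (-⟪y, ξ⟫_ℝ))]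
    linear_combination (-(ech (-⟪y, (k : E n)⟫_ℝ) *
      (((𝓕 f : L2 n) (ξ + k) * conj ((𝓕 φ : L2 n) (ξ + k))) *
      conj ((𝓕 g : L2 n) ξ * conj ((𝓕 ψ : L2 n) ξ))))) * ech_mul_conj (-⟪y, ξ⟫_ℝ)

/-! ### Bessel sequences and frame expansions -/

section Frames

variable {H : Type*} [NormedAddCommGroup H] [InnerProductSpace ℂ H] {ι : Type*}

theorem IsBessel.exists_bound {f : ι → H} (hf : IsBessel f) :
    ∃ C : ℝ, 0 ≤ C ∧ ∀ (x : H) (s : Finset ι), ∑ i ∈ s, ‖⟪f i, x⟫_ℂ‖ ^ 2 ≤ (C * ‖x‖) ^ 2 := by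
  obtain ⟨C, hC⟩ := hf
  refine ⟨Real.sqrt (max C 0), Real.sqrt_nonneg _, fun x s => ?_⟩
  rw [mul_pow, Real.sq_sqrt (le_max_right _ _)]
  refine ((hC x).1.sum_le_tsum s fun _ _ => by positivity).trans ((hC x).2.trans ?_)
  gcongr
  exact le_max_left _ _

/-- The synthesis operator of a Bessel sequence is bounded. -/
theorem IsBessel.exists_norm_sum_le {f : ι → H} (hf : IsBessel f) :
    ∃ C : ℝ, 0 ≤ C ∧ ∀ (a : ι → ℂ) (s : Finset ι),
      ‖∑ i ∈ s, a i • f i‖ ≤ C * Real.sqrt (∑ i ∈ s, ‖a i‖ ^ 2) := by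
  obtain ⟨C, hC0, hC⟩ := hf.exists_bound
  refine ⟨C, hC0, fun a s => ?_⟩
  set u := ∑ i ∈ s, a i • f i with hu
  have h1 : ‖u‖ * ‖u‖ ≤ (C * Real.sqrt (∑ i ∈ s, ‖a i‖ ^ 2)) * ‖u‖ := by
    calc ‖u‖ * ‖u‖ = ‖⟪u, u⟫_ℂ‖ := by
          rw [← inner_self_re_eq_norm (𝕜 := ℂ), ← inner_self_eq_norm_mul_norm (𝕜 := ℂ)]
      _ = ‖∑ i ∈ s, conj (a i) * ⟪f i, u⟫_ℂ‖ := by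
          have h2 : ⟪u, u⟫_ℂ = ⟪∑ i ∈ s, a i • f i, u⟫_ℂ := by rw [← hu]
          rw [h2, sum_inner]
          simp only [inner_smul_left]
      _ ≤ ∑ i ∈ s, ‖a i‖ * ‖⟪f i, u⟫_ℂ‖ := by
          refine (norm_sum_le _ _).trans (Finset.sum_le_sum fun i _ => ?_)
          rw [norm_mul, RCLike.norm_conj]
      _ ≤ Real.sqrt (∑ i ∈ s, ‖a i‖ ^ 2) * Real.sqrt (∑ i ∈ s, ‖⟪f i, u⟫_ℂ‖ ^ 2) :=
          Real.sum_mul_le_sqrt_mul_sqrt _ _ _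
      _ ≤ Real.sqrt (∑ i ∈ s, ‖a i‖ ^ 2) * (C * ‖u‖) := by
          gcongr
          exact Real.sqrt_le_iff.2 ⟨by positivity, hC u s⟩
      _ = _ := by ring
  rcases (norm_nonneg u).eq_or_lt with h0 | h0
  · rw [← h0]; positivity
  · exact le_of_mul_le_mul_right h1 h0

theorem IsBessel.summable_smul [CompleteSpace H] {f : ι → H} (hf : IsBessel f) {a : ι → ℂ}
    (ha : Summable fun i => ‖a i‖ ^ 2) : Summable fun i => a i • f i := by
  obtain ⟨C, hC0, hC⟩ := hf.exists_norm_sum_le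
  rw [summable_iff_vanishing_norm]
  intro ε hε
  obtain ⟨s, hs⟩ := summable_iff_vanishing_norm.1 ha ((ε / (C + 1)) ^ 2) (by positivity)
  refine ⟨s, fun t ht => (hC a t).trans_lt ?_⟩
  have h1 := hs t ht
  rw [Real.norm_of_nonneg (Finset.sum_nonneg fun _ _ => by positivity)] at h1
  have h2 : Real.sqrt (∑ i ∈ t, ‖a i‖ ^ 2) ≤ ε / (C + 1) :=
    Real.sqrt_le_iff.2 ⟨by positivity, h1.le⟩
  calc C * Real.sqrt (∑ i ∈ t, ‖a i‖ ^ 2) ≤ C * (ε / (C + 1)) := by gcongr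
    _ < ε := by
      rw [mul_div_assoc', div_lt_iff₀ (by positivity)]
      nlinarith

/-- A pair of Bessel sequences reproduces every vector as soon as it does so weakly on a set with
trivial orthogonal complement. -/
theorem hasSum_of_total [CompleteSpace H] {f g : ι → H} (hf : IsBessel f) (hg : IsBessel g)
    {D : Set H} (hD : ∀ h : H, (∀ d ∈ D, ⟪d, h⟫_ℂ = 0) → h = 0)
    (hfg : ∀ x ∈ D, ∀ y ∈ D, HasSum (fun i => ⟪g i, x⟫_ℂ * conj ⟪f i, y⟫_ℂ) ⟪y, x⟫_ℂ) (x : H) :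
    HasSum (fun i => ⟪g i, x⟫_ℂ • f i) x := by
  have hsum : ∀ x, Summable fun i => ⟪g i, x⟫_ℂ • f i := fun x =>
    hf.summable_smul (hg.choose_spec x).1
  obtain ⟨C, hC0, hC⟩ := hf.exists_norm_sum_le
  obtain ⟨C', hC'0, hC'⟩ := hg.exists_bound
  let S : H →L[ℂ] H := LinearMap.mkContinuous
    { toFun := fun x => ∑' i, ⟪g i, x⟫_ℂ • f i
      map_add' := fun x y => by
        rw [← (hsum x).tsum_add (hsum y)]
        simp only [inner_add_right, add_smul]
      map_smul' := fun c x => by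
        rw [RingHom.id_apply, ← (hsum x).tsum_const_smul]
        simp only [inner_smul_right, mul_smul] } (C * C') (fun x => by
      refine le_of_tendsto (hsum x).hasSum.norm (Eventually.of_forall fun s => ?_)
      refine (hC _ s).trans ?_
      rw [mul_assoc]
      gcongr
      exact Real.sqrt_le_iff.2 ⟨by positivity, hC' x s⟩)
  have hS : ∀ x, HasSum (fun i => ⟪g i, x⟫_ℂ • f i) (S x) := fun x => (hsum x).hasSum
  have hSD : ∀ x ∈ D, S x = x := by
    intro x hx
    rw [← sub_eq_zero]
    refine hD _ fun y hy => ?_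
    rw [inner_sub_right, sub_eq_zero]
    refine HasSum.unique ?_ (hfg x hx y hy)
    have := (hS x).mapL (innerSL ℂ y)
    simpa only [innerSL_apply_apply, inner_smul_right, inner_conj_symm] using this
  have hdense : Dense (Submodule.span ℂ D : Set H) := by
    rw [Submodule.dense_iff_topologicalClosure_eq_top, Submodule.topologicalClosure_eq_top_iff,
      Submodule.eq_bot_iff]
    intro h hh
    exact hD h fun d hd => (Submodule.mem_orthogonal _ _).1 hh d (Submodule.subset_span hd)
  have hid : S = ContinuousLinearMap.id ℂ H :=
    ContinuousLinearMap.ext_on hdense fun x hx => hSD x hx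
  have := hS x
  rwa [hid] at this

end Frames

/-! ### Uniqueness of absolutely convergent almost periodic series -/

/-- The coefficients of an absolutely convergent series of characters of `ℝⁿ` are determined by its
sum, after grouping equal frequencies. They are recovered as means against Gaussians of growing
width. -/
theorem tsum_fiber_eq_of_hasSum_const {ι : Type*} [Countable ι] {c : ι → ℂ} {a : ι → E n}
    (hc : Summable c) {w : ℂ} (h : ∀ x : E n, HasSum (fun i => ech (-⟪x, a i⟫_ℝ) * c i) w)
    (α : E n) : ∑' i, {i | a i = α}.indicator c i = if α = 0 then w else 0 := by
  set μ := ProbabilityTheory.stdGaussian (E n) with hμ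
  have hcf : ∀ (t : ℕ) (β : E n), ∫ x, ech ⟪(t : ℝ) • x, β⟫_ℝ ∂μ =
      Real.exp (-(2 * Real.pi * t * ‖β‖) ^ 2 / 2) := by
    intro t β
    have h1 := ProbabilityTheory.charFun_stdGaussian ((2 * Real.pi * t) • β)
    rw [charFun_apply] at h1
    rw [Complex.ofReal_exp]
    convert h1 using 1
    · refine integral_congr_ae (Eventually.of_forall fun x => ?_)
      simp only [ech, inner_smul_left, inner_smul_right]
      congr 1
      push_cast
      simp [mul_assoc]
    · congr 1
      rw [norm_smul, Real.norm_of_nonneg (by positivity)]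
      push_cast
      rfl
  have hlim : ∀ β : E n, Tendsto (fun t : ℕ =>
      (Real.exp (-(2 * Real.pi * t * ‖β‖) ^ 2 / 2) : ℂ)) atTop (𝓝 (if β = 0 then 1 else 0)) := by
    intro β
    split_ifs with hβ
    · simp [hβ]
    · rw [← Complex.ofReal_zero]
      refine (Complex.continuous_ofReal.tendsto 0).comp (Real.tendsto_exp_atBot.comp ?_)
      have hβ' : 0 < ‖β‖ := norm_pos_iff.2 hβ
      have h1 : Tendsto (fun t : ℕ => 2 * Real.pi * (t : ℝ) * ‖β‖) atTop atTop :=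
        (tendsto_natCast_atTop_atTop.const_mul_atTop (by positivity)).atTop_mul_const hβ'
      have h2 := ((tendsto_pow_atTop two_ne_zero).comp h1).atTop_div_const
        (show (0 : ℝ) < 2 by norm_num)
      refine (tendsto_neg_atTop_atBot.comp h2).congr fun t => ?_
      simp only [Function.comp_apply, neg_div]
  have hmean : ∀ t : ℕ,
      ∑' i, c i * (Real.exp (-(2 * Real.pi * t * ‖α - a i‖) ^ 2 / 2) : ℂ) =
        w * (Real.exp (-(2 * Real.pi * t * ‖α‖) ^ 2 / 2) : ℂ) := by
    intro t
    have hcont : ∀ β : E n, Continuous fun x : E n => ech ⟪(t : ℝ) • x, β⟫_ℝ := fun β => by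
      fun_prop
    have hi : ∀ β : E n, Integrable (fun x : E n => ech ⟪(t : ℝ) • x, β⟫_ℝ) μ := fun β =>
      (integrable_const (1 : ℝ)).mono' (hcont β).aestronglyMeasurable
        (Eventually.of_forall fun x => (norm_ech _).le)
    have h1 := hasSum_integral_of_summable_integral_norm (μ := μ)
      (F := fun i x => c i * ech ⟪(t : ℝ) • x, α - a i⟫_ℝ) (fun i => (hi _).const_mul _)
      (by simpa using hc.norm)
    simp only [integral_const_mul, hcf] at h1
    rw [h1.tsum_eq, ← hcf, ← integral_const_mul]
    refine integral_congr_ae (Eventually.of_forall fun x => ?_)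
    have h2 := (h ((t : ℝ) • x)).mul_right (ech ⟪(t : ℝ) • x, α⟫_ℝ)
    refine Eq.trans (tsum_congr fun i => ?_) h2.tsum_eq
    rw [inner_sub_right, sub_eq_neg_add, ech_add]
    ring
  have hdom : Tendsto (fun t : ℕ =>
      ∑' i, c i * (Real.exp (-(2 * Real.pi * t * ‖α - a i‖) ^ 2 / 2) : ℂ)) atTop
      (𝓝 (∑' i, c i * (if α - a i = 0 then 1 else 0))) := by
    refine tendsto_tsum_of_dominated_convergence hc.norm (fun i => (hlim _).const_mul _)
      (Eventually.of_forall fun t i => ?_)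
    rw [norm_mul, Complex.norm_real, Real.norm_of_nonneg (Real.exp_pos _).le]
    refine mul_le_of_le_one_right (norm_nonneg _) (Real.exp_le_one_iff.2 ?_)
    rw [neg_div]
    exact neg_nonpos.2 (by positivity)
  simp only [hmean] at hdom
  have h3 := tendsto_nhds_unique hdom ((hlim α).const_mul w)
  have h4 : ∀ i, {i | a i = α}.indicator c i = c i * (if α - a i = 0 then 1 else 0) := by
    intro i
    by_cases hi : a i = α
    · simp [hi]
    · have : α - a i ≠ 0 := fun h0 => hi (sub_eq_zero.1 h0).symm
      simp [hi, this]
  simp only [h4]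
  rw [h3]
  split_ifs <;> simp

/-! ### Absolute convergence of the correlation coefficients -/

theorem fourier_dilation_inv (G : GL (Fin n) ℝ) (f : L2 n) :
    (𝓕 (dilation G⁻¹ f) : L2 n) =ᵐ[volume]
      fun ξ => (Real.sqrt (absDet G) : ℂ) * (𝓕 f : L2 n) (glEquiv (glTranspose G) ξ) := by
  have h := fourier_dilation G⁻¹ f
  rwa [glTranspose_inv, inv_inv, absDet_glTranspose] at h

/-- The Fourier transform of `f` is bounded by `M` and supported in `K`. -/
def BandIn (K : Set (E n)) (M : NNReal) (f : L2 n) : Prop :=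
  ∀ᵐ ξ : E n, ‖(𝓕 f : L2 n) ξ‖ₑ ≤ M * K.indicator 1 ξ

theorem BandIn.fourier_dilation_inv {K : Set (E n)} {M : NNReal} {f : L2 n} (hf : BandIn K M f)
    (G : GL (Fin n) ℝ) : ∀ᵐ ξ : E n, ‖(𝓕 (dilation G⁻¹ f) : L2 n) ξ‖ₑ ≤
      ENNReal.ofReal (Real.sqrt (absDet G)) * M *
        K.indicator 1 (glEquiv (glTranspose G) ξ) := by
  filter_upwards [WaveletOversampling.fourier_dilation_inv G f,
    (quasiMeasurePreserving_glEquiv (glTranspose G)).ae hf] with ξ h1 h2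
  rw [h1, enorm_mul, mul_assoc]
  gcongr
  rw [← ofReal_norm, Complex.norm_real, Real.norm_of_nonneg (Real.sqrt_nonneg _)]

theorem BandIn.hasBoundedBand_dilation_inv {K : Set (E n)} (hK : Bornology.IsBounded K) {M : NNReal}
    {f : L2 n} (hf : BandIn K M f) (G : GL (Fin n) ℝ) : HasBoundedBand (dilation G⁻¹ f) := by
  have hb : Bornology.IsBounded (glEquiv (glTranspose G)⁻¹ '' K) :=
    (glEquiv (glTranspose G)⁻¹ : E n →L[ℝ] E n).lipschitz.isBounded_image hK
  obtain ⟨R, hR⟩ := hb.subset_closedBall 0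
  refine ⟨Real.sqrt (absDet G) * M, R, ?_⟩
  filter_upwards [hf.fourier_dilation_inv G] with ξ h
  have h' := ENNReal.toReal_mono (by
    refine ENNReal.mul_ne_top (by finiteness) ?_
    by_cases hm : glEquiv (glTranspose G) ξ ∈ K <;> simp [hm]) h
  rw [toReal_enorm] at h'
  refine h'.trans ?_
  by_cases hm : glEquiv (glTranspose G) ξ ∈ K
  · have : ξ ∈ Metric.closedBall 0 R :=
      hR ⟨_, hm, glEquiv_inv_apply_self _ _⟩
    simp [hm, Set.indicator_of_mem this, ENNReal.toReal_ofReal (Real.sqrt_nonneg _)]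
  · rw [Set.indicator_of_notMem hm]
    simp only [mul_zero, ENNReal.toReal_zero]
    exact Set.indicator_nonneg (fun _ _ => by positivity) _

/-- The energy of `φ̂` on the preimage of `K` under `Bʲ`, where `B = Aᵀ`. -/
def bandEnergy (A : GL (Fin n) ℝ) (φ : L2 n) (K : Set (E n)) (j : ℤ) : ℝ≥0∞ :=
  ∫⁻ ξ : E n, K.indicator 1 (glEquiv (glTranspose A ^ j) ξ) * ‖(𝓕 φ : L2 n) ξ‖ₑ ^ 2

theorem measurable_indicator_glEquiv {K : Set (E n)} (hK : MeasurableSet K) (G : GL (Fin n) ℝ) :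
    Measurable fun ξ : E n => (K.indicator 1 (glEquiv G ξ) : ℝ≥0∞) :=
  (measurable_one.indicator hK).comp (glEquiv G).continuous.measurable

theorem lintegral_enorm_fourier_sq_lt_top (φ : L2 n) :
    ∫⁻ ξ : E n, ‖(𝓕 φ : L2 n) ξ‖ₑ ^ 2 < ∞ := by
  have := lintegral_rpow_enorm_lt_top_of_eLpNorm_lt_top (p := 2) two_ne_zero ENNReal.ofNat_ne_top
    (Lp.memLp (𝓕 φ : L2 n)).2
  simpa using this

theorem bandEnergy_ne_top (A : GL (Fin n) ℝ) (φ : L2 n) (K : Set (E n)) (j : ℤ) :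
    bandEnergy A φ K j ≠ ∞ := by
  refine ((lintegral_mono fun ξ => ?_).trans_lt (lintegral_enorm_fourier_sq_lt_top φ)).ne
  by_cases h : glEquiv (glTranspose A ^ j) ξ ∈ K
  · rw [Set.indicator_of_mem h, Pi.one_apply, one_mul]
  · rw [Set.indicator_of_notMem h, zero_mul]
    exact zero_le

/-- For a band `K` in an annulus, the energies of `φ̂` on the sets `B⁻ʲ K`, `j ∈ ℤ`, are
summable, because these sets overlap a bounded number of times. -/
theorem tsum_bandEnergy_ne_top {A : GL (Fin n) ℝ} (hA : IsExpansive A) (φ : L2 n) {K : Set (E n)}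
    (hKm : MeasurableSet K) {a b : ℝ} (ha : 0 < a) (hK : ∀ x ∈ K, a ≤ ‖x‖ ∧ ‖x‖ ≤ b) :
    ∑' j : ℤ, bandEnergy A φ K j ≠ ∞ := by
  obtain ⟨m, hm⟩ := hA.exists_card_le (b := b) ha
  unfold bandEnergy
  have hmeas : AEMeasurable (fun ξ : E n => ‖(𝓕 φ : L2 n) ξ‖ₑ ^ 2) :=
    (Lp.aestronglyMeasurable _).enorm.pow_const 2
  rw [← lintegral_tsum fun j => (measurable_indicator_glEquiv hKm _).aemeasurable.fun_mul hmeas]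
  have hle : ∀ ξ : E n, ∑' j : ℤ, K.indicator 1 (glEquiv (glTranspose A ^ j) ξ) *
      ‖(𝓕 φ : L2 n) ξ‖ₑ ^ 2 ≤ m * ‖(𝓕 φ : L2 n) ξ‖ₑ ^ 2 := by
    intro ξ
    rw [ENNReal.tsum_mul_right]
    gcongr
    rw [ENNReal.tsum_eq_iSup_sum]
    refine iSup_le fun s => ?_
    classical
    have h1 : ∑ j ∈ s, (K.indicator 1 (glEquiv (glTranspose A ^ j) ξ) : ℝ≥0∞) =
        ((s.filter fun j => glEquiv (glTranspose A ^ j) ξ ∈ K).card : ℝ≥0∞) := by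
      simp only [Set.indicator_apply, Pi.one_apply, Finset.sum_boole]
    rw [h1]
    exact_mod_cast hm ξ _ fun j hj => hK _ (Finset.mem_filter.1 hj).2
  refine ((lintegral_mono hle).trans_lt ?_).ne
  rw [lintegral_const_mul'' _ hmeas]
  exact ENNReal.mul_lt_top (by finiteness) (lintegral_enorm_fourier_sq_lt_top φ)

/-- The number of points of `ξ + ℤⁿ` that `G` maps into `K`. -/
def latticeCount (G : GL (Fin n) ℝ) (K : Set (E n)) (ξ : E n) : ℝ≥0∞ :=
  ∑' k : integerLattice n, K.indicator 1 (glEquiv G (ξ + k))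

theorem latticeCount_le_of_card_le {G : GL (Fin n) ℝ} {K : Set (E n)} {ξ : E n} {N : ℝ≥0∞}
    (h : ∀ s : Finset (integerLattice n), (∀ k ∈ s, glEquiv G (ξ + k) ∈ K) → (s.card : ℝ≥0∞) ≤ N) :
    latticeCount G K ξ ≤ N := by
  classical
  rw [latticeCount, ENNReal.tsum_eq_iSup_sum]
  refine iSup_le fun s => ?_
  have h1 : ∑ k ∈ s, (K.indicator 1 (glEquiv G (ξ + k)) : ℝ≥0∞) =
      ((s.filter fun k : integerLattice n => glEquiv G (ξ + k) ∈ K).card : ℝ≥0∞) := by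
    simp only [Set.indicator_apply, Pi.one_apply, Finset.sum_boole]
  rw [h1]
  exact h _ fun k hk => (Finset.mem_filter.1 hk).2

/-- If `G⁻¹` does not expand lengths by more than `C`, two points of `ξ + ℤⁿ` cannot be mapped by
`G` into the same ball of radius less than `1 / (2C)`. -/
theorem eq_of_mem_closedBall {G : GL (Fin n) ℝ} {C : ℝ} (hC : 0 ≤ C)
    (hG : ∀ x, ‖glEquiv G⁻¹ x‖ ≤ C * ‖x‖) {c : E n} {r : ℝ} (hr : C * (2 * r) < 1) {ξ k k' : E n}
    (hk : k ∈ integerLattice n) (hk' : k' ∈ integerLattice n)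
    (h : glEquiv G (ξ + k) ∈ Metric.closedBall c r)
    (h' : glEquiv G (ξ + k') ∈ Metric.closedBall c r) : k = k' := by
  by_contra hne
  have h1 := one_le_norm_of_mem_integerLattice (sub_mem hk hk') (sub_ne_zero.2 hne)
  have h2 : k - k' = glEquiv G⁻¹ (glEquiv G (ξ + k) - glEquiv G (ξ + k')) := by
    rw [← map_sub, glEquiv_inv_apply_self]; abel
  have h3 : ‖glEquiv G (ξ + k) - glEquiv G (ξ + k')‖ ≤ 2 * r := by
    rw [← dist_eq_norm, two_mul]
    exact dist_triangle_right _ _ c |>.trans (add_le_add h h')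
  have h4 : ‖k - k'‖ ≤ C * (2 * r) := by
    rw [h2]
    exact (hG _).trans (by gcongr)
  linarith

theorem latticeCount_le_one {G : GL (Fin n) ℝ} {C : ℝ} (hC : 0 ≤ C)
    (hG : ∀ x, ‖glEquiv G⁻¹ x‖ ≤ C * ‖x‖) {c : E n} {r : ℝ} (hr : C * (2 * r) < 1) (ξ : E n) :
    latticeCount G (Metric.closedBall c r) ξ ≤ 1 := by
  refine latticeCount_le_of_card_le fun s hs => ?_
  have : s.card ≤ 1 := Finset.card_le_one.2 fun k hk k' hk' =>
    Subtype.ext (eq_of_mem_closedBall hC hG hr k.2 k'.2 (hs k hk) (hs k' hk'))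
  exact_mod_cast this

/-- A packing bound: if `G` does not expand lengths by more than `C`, the number of points of
`ξ + ℤⁿ` that `G` maps into a fixed ball is at most a constant times `|det G|⁻¹`. -/
theorem absDet_mul_latticeCount_le {C : ℝ} (hC : 0 ≤ C) (c : E n) (r : ℝ) :
    ∃ N : NNReal, ∀ (G : GL (Fin n) ℝ), (∀ x, ‖glEquiv G x‖ ≤ C * ‖x‖) → ∀ ξ : E n,
      ENNReal.ofReal (absDet G) * latticeCount G (Metric.closedBall c r) ξ ≤ N := by
  set v : ℝ≥0∞ := volume (Metric.ball (0 : E n) (1 / 2)) with hv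
  set V : ℝ≥0∞ := volume (Metric.closedBall c (r + C)) with hV
  have hv0 : v ≠ 0 := (Metric.measure_ball_pos volume 0 (by norm_num)).ne'
  have hvt : v ≠ ∞ := measure_ball_lt_top.ne
  have hVt : V ≠ ∞ := measure_closedBall_lt_top.ne
  refine ⟨(V / v).toNNReal, fun G hG ξ => ?_⟩
  rw [ENNReal.coe_toNNReal (ENNReal.div_lt_top hVt hv0).ne]
  have hd0 : ENNReal.ofReal (absDet G) ≠ 0 := (ENNReal.ofReal_pos.2 (absDet_pos G)).ne'
  have hmain : latticeCount G (Metric.closedBall c r) ξ ≤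
      (V / v) / ENNReal.ofReal (absDet G) := by
    refine latticeCount_le_of_card_le fun s hs => ?_
    rw [ENNReal.le_div_iff_mul_le (Or.inl hd0) (Or.inl ENNReal.ofReal_ne_top),
      ENNReal.le_div_iff_mul_le (Or.inl hv0) (Or.inl hvt)]
    have hball : ∀ k : integerLattice n,
        volume (glEquiv G '' Metric.ball (ξ + (k : E n)) (1 / 2)) =
          ENNReal.ofReal (absDet G) * v := by
      intro k
      rw [volume_image_glEquiv, hv]
      congr 1
      exact Measure.addHaar_ball_center _ _ _
    have hdisj : Set.PairwiseDisjoint (s : Set (integerLattice n))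
        fun k => glEquiv G '' Metric.ball (ξ + (k : E n)) (1 / 2) := by
      intro k _ k' _ hne
      refine (Set.disjoint_image_iff (glEquiv G).injective).2 (Metric.ball_disjoint_ball ?_)
      rw [dist_add_left, dist_eq_norm]
      have := one_le_norm_of_mem_integerLattice (sub_mem k.2 k'.2)
        (sub_ne_zero.2 fun h => hne (Subtype.ext h))
      linarith
    have hsub : (⋃ k ∈ s, glEquiv G '' Metric.ball (ξ + (k : E n)) (1 / 2)) ⊆
        Metric.closedBall c (r + C) := by
      refine Set.iUnion₂_subset fun k hk => ?_
      rintro _ ⟨x, hx, rfl⟩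
      have h1 := hs k hk
      rw [Metric.mem_closedBall] at h1 ⊢
      have h2 : dist (glEquiv G x) (glEquiv G (ξ + k)) ≤ C := by
        rw [dist_eq_norm, ← map_sub]
        refine (hG _).trans (mul_le_of_le_one_right hC ?_)
        rw [← dist_eq_norm]
        exact (Metric.mem_ball.1 hx).le.trans (by norm_num)
      exact (dist_triangle _ _ _).trans (by linarith)
    have h3 := measure_mono (μ := volume) hsub
    rw [measure_biUnion_finset hdisj fun k _ =>
      (measurableEmbedding_glEquiv G).measurableSet_image.2 measurableSet_ball] at h3
    simp only [hball, Finset.sum_const, nsmul_eq_mul] at h3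
    rwa [mul_assoc]
  calc ENNReal.ofReal (absDet G) * latticeCount G (Metric.closedBall c r) ξ
      ≤ ENNReal.ofReal (absDet G) * ((V / v) / ENNReal.ofReal (absDet G)) := by gcongr
    _ ≤ V / v := ENNReal.mul_div_le

/-- The correlation coefficients at one scale, summed over the lattice, are bounded by the energies
of the generators on the bands at that scale. -/
theorem tsum_enorm_corr_le (A : GL (Fin n) ℝ) (j : ℤ) {K K' : Set (E n)} (hK : MeasurableSet K)
    (hK' : MeasurableSet K') {M : NNReal} {f g : L2 n} (hf : BandIn K M f) (hg : BandIn K' M g)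
    (φ ψ : L2 n) {N : ℝ≥0∞} (hN : ∀ ξ, latticeCount (glTranspose A ^ j) K ξ ≤ N)
    (hN' : ∀ ξ, latticeCount (glTranspose A ^ j) K' ξ ≤ N) :
    ∑' k : integerLattice n, ‖corr (dilation (A ^ j)⁻¹ f) (dilation (A ^ j)⁻¹ g) φ ψ k‖ₑ ≤
      M ^ 2 * (ENNReal.ofReal (absDet (glTranspose A ^ j)) * N) *
        (bandEnergy A φ K j + bandEnergy A ψ K' j) := by
  set T := glEquiv (glTranspose A ^ j) with hT
  set D : ℝ≥0∞ := ENNReal.ofReal (absDet (glTranspose A ^ j)) with hD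
  have hdet : absDet (A ^ j) = absDet (glTranspose A ^ j) := by
    rw [← glTranspose_zpow, absDet_glTranspose]
  have hsq : ENNReal.ofReal (Real.sqrt (absDet (A ^ j))) *
      ENNReal.ofReal (Real.sqrt (absDet (A ^ j))) = D := by
    rw [← ENNReal.ofReal_mul (Real.sqrt_nonneg _), Real.mul_self_sqrt (absDet_pos _).le, hdet]
  have hmφ : AEMeasurable (fun ξ : E n => ‖(𝓕 φ : L2 n) ξ‖ₑ ^ 2) :=
    (Lp.aestronglyMeasurable _).enorm.pow_const 2
  have hmψ : AEMeasurable (fun ξ : E n => ‖(𝓕 ψ : L2 n) ξ‖ₑ ^ 2) :=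
    (Lp.aestronglyMeasurable _).enorm.pow_const 2
  have hmK : Measurable fun ξ : E n => (K.indicator 1 (T ξ) : ℝ≥0∞) :=
    measurable_indicator_glEquiv hK _
  have hmK' : Measurable fun ξ : E n => (K'.indicator 1 (T ξ) : ℝ≥0∞) :=
    measurable_indicator_glEquiv hK' _
  -- `P ξ` and `Q ξ` are the localized energy densities of the two generators
  set P : E n → ℝ≥0∞ := fun ξ => K.indicator 1 (T ξ) * ‖(𝓕 φ : L2 n) ξ‖ₑ ^ 2 with hP
  set Q : E n → ℝ≥0∞ := fun ξ => K'.indicator 1 (T ξ) * ‖(𝓕 ψ : L2 n) ξ‖ₑ ^ 2 with hQ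
  have hmP : AEMeasurable P := hmK.aemeasurable.fun_mul hmφ
  have hmQ : AEMeasurable Q := hmK'.aemeasurable.fun_mul hmψ
  have hk : ∀ k : integerLattice n,
      ‖corr (dilation (A ^ j)⁻¹ f) (dilation (A ^ j)⁻¹ g) φ ψ k‖ₑ ≤
        M ^ 2 * D * ((∫⁻ ξ, K'.indicator 1 (T (ξ + (-k : integerLattice n))) * P ξ) +
          ∫⁻ ξ, K.indicator 1 (T (ξ + k)) * Q ξ) := by
    intro k
    have hshift : ∫⁻ ξ, K'.indicator 1 (T (ξ + (-k : integerLattice n))) * P ξ =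
        ∫⁻ ξ, K'.indicator 1 (T ξ) * P (ξ + k) := by
      rw [← lintegral_add_right_eq_self _ (k : E n)]
      simp
    have hmP' : AEMeasurable fun ξ => P (ξ + k) :=
      hmP.comp_quasiMeasurePreserving (quasiMeasurePreserving_add (k : E n))
    rw [hshift, ← lintegral_add_left' (hmK'.aemeasurable.fun_mul hmP'), ← lintegral_const_mul' _ _
      (by finiteness)]
    refine (enorm_integral_le_lintegral_enorm _).trans (lintegral_mono_ae ?_)
    filter_upwards [(quasiMeasurePreserving_add (k : E n)).ae (hf.fourier_dilation_inv (A ^ j)),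
      hg.fourier_dilation_inv (A ^ j)] with ξ h1 h2
    rw [glTranspose_zpow, ← hT] at h1 h2
    simp only [enorm_mul, RCLike.enorm_conj]
    set s := ENNReal.ofReal (Real.sqrt (absDet (A ^ j)))
    set x := ‖(𝓕 φ : L2 n) (ξ + k)‖ₑ
    set y := ‖(𝓕 ψ : L2 n) ξ‖ₑ
    have hxy : x * y ≤ x ^ 2 + y ^ 2 := by
      rcases le_total x y with h | h
      · calc x * y ≤ y * y := by gcongr
          _ ≤ x ^ 2 + y ^ 2 := by rw [← sq]; exact le_add_self
      · calc x * y ≤ x * x := by gcongr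
          _ ≤ x ^ 2 + y ^ 2 := by rw [← sq]; exact le_self_add
    calc _ ≤ (s * M * K.indicator 1 (T (ξ + k)) * x) * (s * M * K'.indicator 1 (T ξ) * y) := by
          gcongr
      _ = M ^ 2 * (s * s) * (K.indicator 1 (T (ξ + k)) * K'.indicator 1 (T ξ) * (x * y)) := by ring
      _ ≤ M ^ 2 * (s * s) *
          (K.indicator 1 (T (ξ + k)) * K'.indicator 1 (T ξ) * (x ^ 2 + y ^ 2)) := by gcongr
      _ = _ := by rw [hsq]; simp only [hP, hQ]; ring
  refine (ENNReal.tsum_le_tsum hk).trans ?_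
  have hsh : ∀ (S : Set (E n)), MeasurableSet S → ∀ k : integerLattice n,
      Measurable fun ξ : E n => (S.indicator 1 (T (ξ + k)) : ℝ≥0∞) := fun S hS k =>
    (measurable_indicator_glEquiv hS _).comp (measurable_add_const (k : E n))
  have h1 : ∑' k : integerLattice n, ∫⁻ ξ, K'.indicator 1 (T (ξ + (-k : integerLattice n))) * P ξ ≤
      N * bandEnergy A φ K j := by
    refine ((Equiv.neg (integerLattice n)).tsum_eq
      (fun k : integerLattice n => ∫⁻ ξ, K'.indicator 1 (T (ξ + k)) * P ξ)).trans_le ?_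
    rw [← lintegral_tsum fun k => (hsh K' hK' k).aemeasurable.fun_mul hmP, bandEnergy,
      ← lintegral_const_mul'' _ hmP]
    refine lintegral_mono fun ξ => ?_
    rw [ENNReal.tsum_mul_right]
    gcongr
    exact hN' ξ
  have h2 : ∑' k : integerLattice n, ∫⁻ ξ, K.indicator 1 (T (ξ + k)) * Q ξ ≤
      N * bandEnergy A ψ K' j := by
    rw [← lintegral_tsum fun k => (hsh K hK k).aemeasurable.fun_mul hmQ, bandEnergy,
      ← lintegral_const_mul'' _ hmQ]
    refine lintegral_mono fun ξ => ?_
    rw [ENNReal.tsum_mul_right]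
    gcongr
    exact hN ξ
  rw [ENNReal.tsum_mul_left, ENNReal.tsum_add]
  calc _ ≤ M ^ 2 * D * (N * bandEnergy A φ K j + N * bandEnergy A ψ K' j) := by gcongr
    _ = _ := by ring

/-! ### Functions with small bands -/

/-- The functions whose Fourier transform is bounded and supported in a ball that avoids the
origin and has radius `r` with `2 C r < 1`. -/
def smallBandSet (n : ℕ) (C : ℝ) : Set (L2 n) :=
  {f | ∃ (c : E n) (r : ℝ) (M : NNReal), C * (2 * r) < 1 ∧ r < ‖c‖ ∧
    BandIn (Metric.closedBall c r) M f}

/-- Every `L²` function is the Fourier transform of an `L²` function. -/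
theorem exists_fourier_ae_eq {F : E n → ℂ} (hF : MemLp F 2 volume) :
    ∃ f : L2 n, (𝓕 f : L2 n) =ᵐ[volume] F := by
  refine ⟨𝓕⁻ (hF.toLp F), ?_⟩
  rw [FourierTransform.fourier_fourierInv_eq]
  exact hF.coeFn_toLp

theorem eq_zero_of_forall_inner_smallBandSet (hn : n ≠ 0) {C : ℝ} (hC : 0 < C) (h : L2 n)
    (hh : ∀ d ∈ smallBandSet n C, ⟪d, h⟫_ℂ = 0) : h = 0 := by
  set H : E n → ℂ := ⇑(𝓕 h : L2 n) with hH
  have hmeas : Measurable fun ξ => ‖H ξ‖ := (Lp.stronglyMeasurable (𝓕 h : L2 n)).norm.measurable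
  have hloc : ∀ c : E n, c ≠ 0 → ∃ r > 0, ∀ᵐ ξ, ξ ∈ Metric.closedBall c r → H ξ = 0 := by
    intro c hc
    have hc' : 0 < ‖c‖ := norm_pos_iff.2 hc
    refine ⟨min (‖c‖ / 2) (1 / (4 * C)), by positivity, ?_⟩
    set r := min (‖c‖ / 2) (1 / (4 * C)) with hr
    have hN : ∀ N : ℕ, ∀ᵐ ξ, ξ ∈ Metric.closedBall c r → ‖H ξ‖ ≤ N → H ξ = 0 := by
      intro N
      set S := Metric.closedBall c r ∩ {ξ | ‖H ξ‖ ≤ N} with hS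
      have hSm : MeasurableSet S :=
        Metric.isClosed_closedBall.measurableSet.inter (measurableSet_le hmeas measurable_const)
      obtain ⟨d, hd⟩ := exists_fourier_ae_eq ((Lp.memLp (𝓕 h : L2 n)).indicator hSm)
      have hdD : d ∈ smallBandSet n C := by
        refine ⟨c, r, N, ?_, ?_, ?_⟩
        · have : r ≤ 1 / (4 * C) := min_le_right _ _
          calc C * (2 * r) ≤ C * (2 * (1 / (4 * C))) := by gcongr
            _ < 1 := by field_simp; norm_num
        · exact (min_le_left _ _).trans_lt (half_lt_self hc')
        · filter_upwards [hd] with ξ hξ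
          rw [hξ]
          by_cases hm : ξ ∈ S
          · rw [Set.indicator_of_mem hm, Set.indicator_of_mem hm.1, Pi.one_apply, mul_one,
              ← ofReal_norm]
            exact (ENNReal.ofReal_le_ofReal hm.2).trans (by simp)
          · rw [Set.indicator_of_notMem hm, enorm_zero]
            exact zero_le
      -- `d̂` is the restriction of `ĥ` to `S`, so that `⟨d, h⟩ = ‖d‖²`
      have h1 : ⟪(𝓕 d : L2 n), (𝓕 d : L2 n)⟫_ℂ = 0 := by
        rw [← hh d hdD, ← Lp.inner_fourier_eq d h, L2.inner_def, L2.inner_def]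
        refine integral_congr_ae ?_
        filter_upwards [hd] with ξ hξ
        rw [hξ]
        by_cases hm : ξ ∈ S
        · rw [Set.indicator_of_mem hm]
        · rw [Set.indicator_of_notMem hm]
          simp
      have h2 : (𝓕 d : L2 n) = 0 := inner_self_eq_zero.1 h1
      have h3 : (𝓕 d : L2 n) =ᵐ[volume] 0 := by rw [h2]; exact Lp.coeFn_zero _ _ _
      filter_upwards [hd, h3] with ξ h4 h5 hξ hξ'
      have hm : ξ ∈ S := ⟨hξ, hξ'⟩
      rw [h4, Set.indicator_of_mem hm] at h5
      exact h5
    filter_upwards [ae_all_iff.2 hN] with ξ hξ hmem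
    obtain ⟨N, hN'⟩ := exists_nat_ge ‖H ξ‖
    exact hξ N hmem hN'
  have : Nonempty (Fin n) := ⟨⟨0, Nat.pos_of_ne_zero hn⟩⟩
  have hnull : volume ({ξ : E n | H ξ ≠ 0} \ {0}) = 0 := by
    refine measure_null_of_locally_null _ fun c hc => ?_
    obtain ⟨r, hr, hae⟩ := hloc c hc.2
    refine ⟨Metric.closedBall c r ∩ {ξ | H ξ ≠ 0}, ?_, ?_⟩
    · exact Filter.inter_mem (mem_nhdsWithin_of_mem_nhds (Metric.closedBall_mem_nhds c hr))
        (Filter.mem_of_superset self_mem_nhdsWithin fun x hx => hx.1)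
    · rw [ae_iff] at hae
      refine measure_mono_null (fun ξ hξ => ?_) hae
      exact fun hcon => hξ.2 (hcon hξ.1)
  have hzero : H =ᵐ[volume] 0 := by
    rw [EventuallyEq, ae_iff]
    refine measure_mono_null (fun ξ hξ => ?_) (measure_union_null hnull
      (measure_singleton (0 : E n)))
    by_cases h0 : ξ = 0
    · exact Or.inr h0
    · exact Or.inl ⟨hξ, h0⟩
  have h6 : (𝓕 h : L2 n) = 0 := Lp.ext (hzero.trans (Lp.coeFn_zero _ _ _).symm)
  have h7 : ‖(𝓕 h : L2 n)‖ = 0 := by rw [h6, norm_zero]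
  rwa [Lp.norm_fourier_eq, norm_eq_zero] at h7

/-- At a scale `j ≥ 0`, a function `f₀` with `f̂₀ = 1_K`, for a small ball `K`, has only the
correlation coefficient with `k = 0`, which is the energy of `φ̂` on the band. -/
theorem hasSum_norm_inner_sq_of_indicator {A : GL (Fin n) ℝ} {C : ℝ} (hC : 0 ≤ C) {j : ℤ}
    (hj : ∀ x : E n, ‖glEquiv (glTranspose A ^ j)⁻¹ x‖ ≤ C * ‖x‖) {c : E n} {r : ℝ}
    (hr : C * (2 * r) < 1) {f₀ : L2 n}
    (hf₀ : (𝓕 f₀ : L2 n) =ᵐ[volume] (Metric.closedBall c r).indicator 1) (φ : L2 n) :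
    HasSum (fun γ : integerLattice n => ‖⟪dilation (A ^ j) (translation (γ : E n) φ), f₀⟫_ℂ‖ ^ 2)
      (ENNReal.ofReal (absDet (glTranspose A ^ j)) *
        bandEnergy A φ (Metric.closedBall c r) j).toReal := by
  set K := Metric.closedBall c r with hK
  have hKm : MeasurableSet K := Metric.isClosed_closedBall.measurableSet
  set T := glEquiv (glTranspose A ^ j) with hT
  have hdet : absDet (A ^ j) = absDet (glTranspose A ^ j) := by
    rw [← glTranspose_zpow, absDet_glTranspose]
  have hband : BandIn K 1 f₀ := by
    filter_upwards [hf₀] with ξ hξ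
    rw [hξ]
    by_cases hm : ξ ∈ K <;> simp [hm]
  have hF : ∀ᵐ ξ : E n, (𝓕 (dilation (A ^ j)⁻¹ f₀) : L2 n) ξ =
      (Real.sqrt (absDet (glTranspose A ^ j)) : ℂ) * K.indicator 1 (T ξ) := by
    have := fourier_dilation_inv (A ^ j) f₀
    rw [glTranspose_zpow, ← hT, hdet] at this
    filter_upwards [this, (quasiMeasurePreserving_glEquiv (glTranspose A ^ j)).ae hf₀]
      with ξ h1 h2
    rw [h1, h2]
  have hbb := hband.hasBoundedBand_dilation_inv Metric.isBounded_closedBall (A ^ j)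
  have key := hasSum_inner_mul_inner hbb hbb φ φ 0
  have hne : ∀ k : integerLattice n, k ≠ 0 →
      ech (-⟪(0 : E n), (k : E n)⟫_ℝ) *
        corr (dilation (A ^ j)⁻¹ f₀) (dilation (A ^ j)⁻¹ f₀) φ φ k = 0 := by
    intro k hk
    refine mul_eq_zero_of_right _ (integral_eq_zero_of_ae ?_)
    filter_upwards [hF, (quasiMeasurePreserving_add (k : E n)).ae hF] with ξ h1 h2
    rw [h1, h2, Pi.zero_apply]
    by_cases hm1 : T (ξ + k) ∈ K
    · by_cases hm2 : T ξ ∈ K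
      · refine absurd (Subtype.ext ?_) hk
        refine eq_of_mem_closedBall hC hj hr k.2 (zero_mem (integerLattice n)) (ξ := ξ) hm1 ?_
        rw [ZeroMemClass.coe_zero, add_zero]
        exact hm2
      · rw [Set.indicator_of_notMem hm2]
        simp
    · rw [Set.indicator_of_notMem hm1]
      simp
  have hcorr : corr (dilation (A ^ j)⁻¹ f₀) (dilation (A ^ j)⁻¹ f₀) φ φ 0 =
      (((ENNReal.ofReal (absDet (glTranspose A ^ j)) * bandEnergy A φ K j).toReal : ℝ) : ℂ) := by
    have hm : AEMeasurable fun ξ : E n => K.indicator 1 (T ξ) * ‖(𝓕 φ : L2 n) ξ‖ₑ ^ 2 :=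
      (measurable_indicator_glEquiv hKm _).aemeasurable.fun_mul
        ((Lp.aestronglyMeasurable _).enorm.pow_const 2)
    rw [bandEnergy, ← lintegral_const_mul'' _ hm, ← integral_toReal (hm.const_mul _)
      (ae_of_all _ fun ξ => ENNReal.mul_lt_top ENNReal.ofReal_lt_top (by
        by_cases hmem : T ξ ∈ K
        · rw [Set.indicator_of_mem hmem, Pi.one_apply, one_mul]
          finiteness
        · rw [Set.indicator_of_notMem hmem, zero_mul]
          exact ENNReal.zero_lt_top)), ← integral_complex_ofReal, corr]
    refine integral_congr_ae ?_
    filter_upwards [hF] with ξ h1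
    rw [add_zero, h1]
    by_cases hmem : T ξ ∈ K
    · simp only [Set.indicator_of_mem hmem, Pi.one_apply, mul_one, one_mul, map_mul,
        Complex.conj_ofReal, Complex.conj_conj, ENNReal.toReal_mul, ENNReal.toReal_pow,
        toReal_enorm, ENNReal.toReal_ofReal (absDet_pos _).le, Complex.ofReal_mul,
        Complex.ofReal_pow]
      rw [← Complex.mul_conj']
      have : (Real.sqrt (absDet (glTranspose A ^ j)) : ℂ) *
          (Real.sqrt (absDet (glTranspose A ^ j)) : ℂ) = (absDet (glTranspose A ^ j) : ℂ) := by
        rw [← Complex.ofReal_mul, Real.mul_self_sqrt (absDet_pos _).le]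
      rw [← this]
      ring
    · simp [Set.indicator_of_notMem hmem]
  rw [tsum_eq_single 0 hne, ZeroMemClass.coe_zero, inner_zero_left, neg_zero, ech_zero, one_mul,
    hcorr] at key
  rw [← Complex.hasSum_ofReal]
  refine key.congr_fun fun γ => ?_
  rw [translation_zero, ← inner_dilation_left, Complex.mul_conj', Complex.ofReal_pow]

/-- The Bessel property bounds the energies of `φ̂` on the bands `B⁻ʲ K`, `j ≥ 0`, weighted by
`|det B|ʲ`. -/
theorem tsum_det_mul_bandEnergy_ne_top {A : GL (Fin n) ℝ} {C : ℝ} (hC : 0 ≤ C)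
    (hA : ∀ j : ℤ, j ≤ 0 → ∀ x : E n, ‖glEquiv (glTranspose A ^ j) x‖ ≤ C * ‖x‖) {φ : L2 n}
    (hφ : ∀ f : L2 n, Summable fun p : ℤ × integerLattice n =>
      ‖⟪dilation (A ^ p.1) (translation (p.2 : E n) φ), f⟫_ℂ‖ ^ 2)
    {c : E n} {r : ℝ} (hr : C * (2 * r) < 1) :
    ∑' j : ℤ, (if 0 ≤ j then ENNReal.ofReal (absDet (glTranspose A ^ j)) *
      bandEnergy A φ (Metric.closedBall c r) j else 0) ≠ ∞ := by
  obtain ⟨f₀, hf₀⟩ := exists_fourier_ae_eq (F := (Metric.closedBall c r).indicator 1)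
    (memLp_indicator_const 2 (Metric.isClosed_closedBall (x := c) (ε := r)).measurableSet (1 : ℂ)
      (Or.inr measure_closedBall_lt_top.ne))
  have hs := (hφ f₀).prod
  refine ((ENNReal.tsum_le_tsum fun j => ?_).trans_lt
    (lt_top_iff_ne_top.2 hs.tsum_ofReal_ne_top)).ne
  split_ifs with hj
  · have hj' : ∀ x : E n, ‖glEquiv (glTranspose A ^ j)⁻¹ x‖ ≤ C * ‖x‖ := by
      rw [← zpow_neg]
      exact hA (-j) (by omega)
    rw [(hasSum_norm_inner_sq_of_indicator hC hj' hr hf₀ φ).tsum_eq, ENNReal.ofReal_toReal]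
    exact ENNReal.mul_ne_top ENNReal.ofReal_ne_top (bandEnergy_ne_top _ _ _ _)
  · exact zero_le

/-- The correlation coefficients of functions with small bands are absolutely summable over all
scales and all lattice vectors. -/
theorem tsum_tsum_enorm_corr_ne_top {A : GL (Fin n) ℝ} (hA : IsExpansive A) {C : ℝ} (hC : 0 ≤ C)
    (hAC : ∀ j : ℤ, j ≤ 0 → ∀ x : E n, ‖glEquiv (glTranspose A ^ j) x‖ ≤ C * ‖x‖) {φ ψ : L2 n}
    (hφ : ∀ f : L2 n, Summable fun p : ℤ × integerLattice n =>
      ‖⟪dilation (A ^ p.1) (translation (p.2 : E n) φ), f⟫_ℂ‖ ^ 2)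
    (hψ : ∀ f : L2 n, Summable fun p : ℤ × integerLattice n =>
      ‖⟪dilation (A ^ p.1) (translation (p.2 : E n) ψ), f⟫_ℂ‖ ^ 2)
    {f g : L2 n} (hf : f ∈ smallBandSet n C) (hg : g ∈ smallBandSet n C) :
    ∑' j : ℤ, ∑' k : integerLattice n,
      ‖corr (dilation (A ^ j)⁻¹ f) (dilation (A ^ j)⁻¹ g) φ ψ k‖ₑ ≠ ∞ := by
  obtain ⟨c, r, M, hr, hrc, hfK⟩ := hf
  obtain ⟨c', r', M', hr', hrc', hgK⟩ := hg
  obtain ⟨N, hN⟩ := absDet_mul_latticeCount_le hC c r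
  obtain ⟨N', hN'⟩ := absDet_mul_latticeCount_le hC c' r'
  set K := Metric.closedBall c r with hK
  set K' := Metric.closedBall c' r' with hK'
  have hKm : MeasurableSet K := Metric.isClosed_closedBall.measurableSet
  have hKm' : MeasurableSet K' := Metric.isClosed_closedBall.measurableSet
  have hann : ∀ (c : E n) (r : ℝ), ∀ x ∈ Metric.closedBall c r,
      ‖c‖ - r ≤ ‖x‖ ∧ ‖x‖ ≤ ‖c‖ + r := by
    intro c r x hx
    rw [mem_closedBall_iff_norm] at hx
    constructor
    · have := norm_sub_norm_le c x
      rw [norm_sub_rev] at this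
      linarith
    · have := norm_sub_norm_le x c
      linarith
  have hf2 : BandIn K (max M M') f := by
    filter_upwards [hfK] with ξ h
    refine h.trans ?_
    gcongr
    exact_mod_cast le_max_left M M'
  have hg2 : BandIn K' (max M M') g := by
    filter_upwards [hgK] with ξ h
    refine h.trans ?_
    gcongr
    exact_mod_cast le_max_right M M'
  set S : NNReal := max M M'
  -- the energy `w` summed over all scales, and the weighted energy over the scales `j ≥ 0`
  set w : ℤ → ℝ≥0∞ := fun j => bandEnergy A φ K j + bandEnergy A ψ K' j with hw
  set u : ℤ → ℝ≥0∞ := fun j =>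
    (if 0 ≤ j then ENNReal.ofReal (absDet (glTranspose A ^ j)) * bandEnergy A φ K j else 0) +
    (if 0 ≤ j then ENNReal.ofReal (absDet (glTranspose A ^ j)) * bandEnergy A ψ K' j else 0)
    with hu
  have hwt : ∑' j, w j ≠ ∞ := by
    rw [hw, ENNReal.tsum_add]
    exact ENNReal.add_ne_top.2 ⟨tsum_bandEnergy_ne_top hA φ hKm (sub_pos.2 hrc) (hann c r),
      tsum_bandEnergy_ne_top hA ψ hKm' (sub_pos.2 hrc') (hann c' r')⟩
  have hut : ∑' j, u j ≠ ∞ := by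
    rw [hu, ENNReal.tsum_add]
    exact ENNReal.add_ne_top.2 ⟨tsum_det_mul_bandEnergy_ne_top hC hAC hφ hr,
      tsum_det_mul_bandEnergy_ne_top hC hAC hψ hr'⟩
  have hj : ∀ j : ℤ, ∑' k : integerLattice n,
      ‖corr (dilation (A ^ j)⁻¹ f) (dilation (A ^ j)⁻¹ g) φ ψ k‖ₑ ≤
        S ^ 2 * u j + S ^ 2 * (max N N' : NNReal) * w j := by
    intro j
    rcases le_total 0 j with hj | hj
    · have hj' : ∀ x : E n, ‖glEquiv (glTranspose A ^ j)⁻¹ x‖ ≤ C * ‖x‖ := by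
        rw [← zpow_neg]
        exact hAC (-j) (by omega)
      refine (tsum_enorm_corr_le A j hKm hKm' hf2 hg2 φ ψ (latticeCount_le_one hC hj' hr)
        (latticeCount_le_one hC hj' hr')).trans (le_add_right (le_of_eq ?_))
      simp only [hu, if_pos hj]
      ring
    · have hd0 : ENNReal.ofReal (absDet (glTranspose A ^ j)) ≠ 0 :=
        (ENNReal.ofReal_pos.2 (absDet_pos _)).ne'
      refine (tsum_enorm_corr_le A j hKm hKm' hf2 hg2 φ ψ
        (N := (max N N' : NNReal) / ENNReal.ofReal (absDet (glTranspose A ^ j)))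
        (fun ξ => ?_) (fun ξ => ?_)).trans (le_add_left ?_)
      · rw [ENNReal.le_div_iff_mul_le (Or.inl hd0) (Or.inl ENNReal.ofReal_ne_top), mul_comm]
        exact (hN _ (hAC j hj) ξ).trans (by exact_mod_cast le_max_left N N')
      · rw [ENNReal.le_div_iff_mul_le (Or.inl hd0) (Or.inl ENNReal.ofReal_ne_top), mul_comm]
        exact (hN' _ (hAC j hj) ξ).trans (by exact_mod_cast le_max_right N N')
      · gcongr
        exact ENNReal.mul_div_le
  refine ((ENNReal.tsum_le_tsum hj).trans_lt ?_).ne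
  rw [ENNReal.tsum_add, ENNReal.tsum_mul_left, ENNReal.tsum_mul_left]
  exact ENNReal.add_lt_top.2 ⟨ENNReal.mul_lt_top (by finiteness) (lt_top_iff_ne_top.2 hut),
    ENNReal.mul_lt_top (by finiteness) (lt_top_iff_ne_top.2 hwt)⟩

/-! ### Lattices containing the integer lattice -/

theorem covolume_integerLattice : ZLattice.covolume (integerLattice n) = 1 := by
  rw [ZLattice.covolume_eq_measure_fundamentalDomain _ _ isAddFundamentalDomain_unitCube,
    measureReal_def, unitCube, measure_congr (ZSpan.fundamentalDomain_ae_parallelepiped _ volume)]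
  have h := (EuclideanSpace.basisFun (Fin n) ℝ).volume_parallelepiped
  rw [OrthonormalBasis.coe_toBasis, h, ENNReal.toReal_one]

theorem isZLattice_of_le {Λ : Submodule ℤ (E n)} [DiscreteTopology Λ] (hΛ : integerLattice n ≤ Λ) :
    IsZLattice ℝ Λ where
  span_top := by
    have h : Submodule.span ℝ (integerLattice n : Set (E n)) = ⊤ := IsZLattice.span_top
    rw [eq_top_iff, ← h]
    exact Submodule.span_mono hΛ

/-- The integer lattice as a subgroup of a larger lattice. -/
def integerSubgroup (Λ : Submodule ℤ (E n)) : AddSubgroup Λ :=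
  (integerLattice n).toAddSubgroup.comap Λ.subtype.toAddMonoidHom

theorem mem_integerSubgroup {Λ : Submodule ℤ (E n)} {x : Λ} :
    x ∈ integerSubgroup Λ ↔ (x : E n) ∈ integerLattice n := Iff.rfl

theorem covolume_mul_index {Λ : Submodule ℤ (E n)} [DiscreteTopology Λ]
    (hΛ : integerLattice n ≤ Λ) :
    ZLattice.covolume Λ * ((integerSubgroup Λ).index : ℝ) = 1 := by
  have := isZLattice_of_le hΛ
  have h := ZLattice.covolume_div_covolume_eq_relIndex' (integerLattice n) Λ hΛ
  have h2 : (integerLattice n).toAddSubgroup.relIndex Λ.toAddSubgroup =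
    (integerSubgroup Λ).index := rfl
  rw [covolume_integerLattice, h2] at h
  rw [← h, mul_one_div_cancel (ZLattice.covolume_pos Λ volume).ne']

theorem finite_quotient_integerSubgroup {Λ : Submodule ℤ (E n)} [DiscreteTopology Λ]
    (hΛ : integerLattice n ≤ Λ) : Finite (Λ ⧸ integerSubgroup Λ) := by
  refine AddSubgroup.index_ne_zero_iff_finite.1 fun h => ?_
  have := covolume_mul_index hΛ
  rw [h] at this
  simp at this

theorem ech_eq_one_iff {t : ℝ} : ech t = 1 ↔ ∃ m : ℤ, (m : ℝ) = t := by
  refine ⟨fun h => ?_, ech_eq_one_of_int⟩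
  rw [ech, Complex.exp_eq_one_iff] at h
  obtain ⟨m, hm⟩ := h
  refine ⟨m, ?_⟩
  have hpi : (2 * Real.pi * Complex.I : ℂ) ≠ 0 := Complex.two_pi_I_ne_zero
  have h2 : (t : ℂ) = m := by
    refine mul_right_cancel₀ hpi ?_
    rw [← hm]
    ring
  exact_mod_cast h2.symm

/-- Characters of `Λ` of the form `ech ⟪·, k⟫` with `k ∈ ℤⁿ` only depend on the class modulo
`ℤⁿ`. -/
theorem ech_inner_eq_of_sub_mem {x y k : E n} (hk : k ∈ integerLattice n)
    (h : -x + y ∈ integerLattice n) : ech ⟪x, k⟫_ℝ = ech ⟪y, k⟫_ℝ := by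
  have h1 : ⟪y, k⟫_ℝ = ⟪x, k⟫_ℝ + ⟪-x + y, k⟫_ℝ := by rw [← inner_add_left, add_neg_cancel_left]
  rw [h1, ech_add, ech_eq_one_of_int (inner_mem_int h hk), mul_one]

theorem neg_add_out_mem {Λ : Submodule ℤ (E n)} (x : Λ) :
    -(x : E n) + ((QuotientAddGroup.mk x : Λ ⧸ integerSubgroup Λ).out : E n) ∈
      integerLattice n := by
  have : -x + (QuotientAddGroup.mk x : Λ ⧸ integerSubgroup Λ).out ∈ integerSubgroup Λ :=
    QuotientAddGroup.eq.1 (QuotientAddGroup.out_eq' _).symm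
  simpa [mem_integerSubgroup] using this

theorem ech_inner_out {Λ : Submodule ℤ (E n)} {k : E n} (hk : k ∈ integerLattice n) (x : Λ) :
    ech ⟪((QuotientAddGroup.mk x : Λ ⧸ integerSubgroup Λ).out : E n), k⟫_ℝ =
      ech ⟪(x : E n), k⟫_ℝ :=
  (ech_inner_eq_of_sub_mem hk (neg_add_out_mem x)).symm

/-- The character of `Λ / ℤⁿ` defined by `k ∈ ℤⁿ`. -/
def quotientChar (Λ : Submodule ℤ (E n)) (k : integerLattice n) :
    AddChar (Λ ⧸ integerSubgroup Λ) ℂ where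
  toFun q := ech ⟪(q.out : E n), (k : E n)⟫_ℝ
  map_zero_eq_one' := by
    have := ech_inner_out k.2 (0 : Λ)
    rw [QuotientAddGroup.mk_zero] at this
    rw [this]
    simp
  map_add_eq_mul' q q' := by
    obtain ⟨x, rfl⟩ := QuotientAddGroup.mk_surjective q
    obtain ⟨y, rfl⟩ := QuotientAddGroup.mk_surjective q'
    rw [← QuotientAddGroup.mk_add, ech_inner_out k.2, ech_inner_out k.2, ech_inner_out k.2,
      ← ech_add, ← inner_add_left]
    rfl

theorem quotientChar_apply (Λ : Submodule ℤ (E n)) (k : integerLattice n)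
    (q : Λ ⧸ integerSubgroup Λ) :
    quotientChar Λ k q = ech ⟪(q.out : E n), (k : E n)⟫_ℝ := rfl

theorem quotientChar_eq_zero_iff {Λ : Submodule ℤ (E n)} {k : integerLattice n} :
    quotientChar Λ k = 0 ↔ (k : E n) ∈ dualLattice Λ := by
  rw [mem_dualLattice]
  constructor
  · intro h x hx
    have h1 := DFunLike.congr_fun h (QuotientAddGroup.mk (⟨x, hx⟩ : Λ))
    rw [quotientChar_apply, ech_inner_out k.2, AddChar.zero_apply, ech_eq_one_iff] at h1
    rwa [real_inner_comm]
  · intro h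
    ext q
    rw [quotientChar_apply, AddChar.zero_apply, real_inner_comm]
    exact ech_eq_one_of_int (h _ q.out.2)

open Classical in
theorem sum_quotientChar (Λ : Submodule ℤ (E n)) [Fintype (Λ ⧸ integerSubgroup Λ)]
    (k : integerLattice n) :
    ∑ q : Λ ⧸ integerSubgroup Λ, ech ⟪(q.out : E n), (k : E n)⟫_ℝ =
      if (k : E n) ∈ dualLattice Λ then ((integerSubgroup Λ).index : ℂ) else 0 := by
  have h := AddChar.sum_eq_ite (quotientChar Λ k)
  simp only [quotientChar_eq_zero_iff, quotientChar_apply] at h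
  rw [h, AddSubgroup.index, Nat.card_eq_fintype_card]

/-- Every point of `Λ` is uniquely the sum of a coset representative and an integer vector. -/
def latticeEquiv {Λ : Submodule ℤ (E n)} (hΛ : integerLattice n ≤ Λ) :
    (Λ ⧸ integerSubgroup Λ) × integerLattice n ≃ Λ :=
  Equiv.ofBijective (fun p => p.1.out + ⟨p.2, hΛ p.2.2⟩) <| by
    constructor
    · rintro ⟨q, t⟩ ⟨q', t'⟩ h
      have hq : q = q' := by
        have h1 : ∀ (q : Λ ⧸ integerSubgroup Λ) (t : integerLattice n),
            (QuotientAddGroup.mk (q.out + ⟨t, hΛ t.2⟩ : Λ) : Λ ⧸ integerSubgroup Λ) = q := by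
          intro q t
          conv_rhs => rw [← QuotientAddGroup.out_eq' q]
          refine (QuotientAddGroup.eq.2 ?_).symm
          rw [neg_add_cancel_left]
          exact t.2
        rw [← h1 q t, ← h1 q' t']
        exact congrArg _ h
      subst hq
      have h2 := add_left_cancel h
      exact Prod.ext rfl (Subtype.ext (congrArg (fun x : Λ => (x : E n)) h2))
    · intro x
      have h := neg_add_out_mem x
      refine ⟨(QuotientAddGroup.mk x, ⟨x - (QuotientAddGroup.mk x : Λ ⧸ integerSubgroup Λ).out, ?_⟩),
        ?_⟩
      · have := neg_mem h
        rwa [neg_add, neg_neg, ← sub_eq_add_neg] at this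
      · ext1
        simp

theorem latticeEquiv_apply {Λ : Submodule ℤ (E n)} (hΛ : integerLattice n ≤ Λ)
    (p : (Λ ⧸ integerSubgroup Λ) × integerLattice n) :
    (latticeEquiv hΛ p : E n) = (p.1.out : E n) + p.2 := rfl

open Classical in
/-- Oversampling from `ℤⁿ` to `Λ` projects onto the frequencies in the dual lattice of `Λ`: the
sum over `Λ` is a sum over the finitely many cosets of `ℤⁿ`, and this averages the characters. -/
theorem tsum_inner_mul_inner_eq {Λ : Submodule ℤ (E n)} [DiscreteTopology Λ]
    (hΛ : integerLattice n ≤ Λ) {f g : L2 n} (hf : HasBoundedBand f) (hg : HasBoundedBand g)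
    {φ ψ : L2 n}
    (hs : Summable fun γ : Λ => ⟪translation (γ : E n) φ, f⟫_ℂ *
      conj ⟪translation (γ : E n) ψ, g⟫_ℂ)
    (hc : Summable fun k : integerLattice n => corr f g φ ψ k) :
    ∑' γ : Λ, ⟪translation (γ : E n) φ, f⟫_ℂ * conj ⟪translation (γ : E n) ψ, g⟫_ℂ =
      (integerSubgroup Λ).index *
        ∑' k : integerLattice n, if (k : E n) ∈ dualLattice Λ then corr f g φ ψ k else 0 := by
  have hfin := finite_quotient_integerSubgroup hΛ
  have := Fintype.ofFinite (Λ ⧸ integerSubgroup Λ)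
  have hcoset : ∀ q : Λ ⧸ integerSubgroup Λ, ∑' t : integerLattice n,
      ⟪translation ((latticeEquiv hΛ (q, t) : Λ) : E n) φ, f⟫_ℂ *
        conj ⟪translation ((latticeEquiv hΛ (q, t) : Λ) : E n) ψ, g⟫_ℂ =
      ∑' k : integerLattice n, ech ⟪(q.out : E n), (k : E n)⟫_ℝ * corr f g φ ψ k := by
    intro q
    have h := hasSum_inner_mul_inner hf hg φ ψ (-(q.out : E n))
    simp only [inner_neg_left, neg_neg] at h
    rw [← h.tsum_eq]
    refine tsum_congr fun t => ?_
    rw [latticeEquiv_apply, ← translation_translation, ← translation_translation,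
      inner_translation_left, inner_translation_left (q.out : E n)]
  have hs' := (latticeEquiv hΛ).summable_iff.2 hs
  simp only [Function.comp_def] at hs'
  rw [← (latticeEquiv hΛ).tsum_eq, Summable.tsum_prod hs', tsum_fintype]
  simp only [hcoset]
  rw [← Summable.tsum_finsetSum fun q _ => ?_]
  · rw [← tsum_mul_left]
    refine tsum_congr fun k => ?_
    rw [← Finset.sum_mul, sum_quotientChar]
    split_ifs <;> simp
  · refine hc.norm.of_norm_bounded fun k => ?_
    rw [norm_mul, norm_ech, one_mul]

/-! ### The oversampling theorem -/

theorem IsBessel.summable_mul {H : Type*} [NormedAddCommGroup H] [InnerProductSpace ℂ H]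
    {ι : Type*} {f g : ι → H} (hf : IsBessel f) (hg : IsBessel g) (x y : H) :
    Summable fun i => ⟪g i, x⟫_ℂ * conj ⟪f i, y⟫_ℂ := by
  obtain ⟨C, hC⟩ := hf
  obtain ⟨C', hC'⟩ := hg
  refine ((hC' x).1.add (hC y).1).of_norm_bounded fun i => ?_
  rw [norm_mul, RCLike.norm_conj]
  nlinarith [sq_nonneg (‖⟪g i, x⟫_ℂ‖ - ‖⟪f i, y⟫_ℂ‖), sq_nonneg ‖⟪g i, x⟫_ℂ‖,
    sq_nonneg ‖⟪f i, y⟫_ℂ‖]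

theorem inner_oversampledSystem {L : ℕ} (Φ : Fin L → L2 n) (A : GL (Fin n) ℝ)
    (Λ : Submodule ℤ (E n)) (l : Fin L) (j : ℤ) (γ : Λ) (f : L2 n) :
    ⟪oversampledSystem Φ A Λ (l, j, γ), f⟫_ℂ =
      (Real.sqrt (ZLattice.covolume Λ) : ℂ) *
        ⟪translation (γ : E n) (Φ l), dilation (A ^ j)⁻¹ f⟫_ℂ := by
  have h : oversampledSystem Φ A Λ (l, j, γ) = ((Real.sqrt (ZLattice.covolume Λ) : ℝ) : ℂ) •
      dilation (A ^ j) (translation (γ : E n) (Φ l)) := by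
    simp only [oversampledSystem, waveletSystem]
    rw [← translationₗᵢ_apply, map_smul, ← dilationₗᵢ_apply, map_smul]
    rfl
  rw [h, inner_smul_left, Complex.conj_ofReal, inner_dilation_left]

/-- If membership in `P` is constant along the fibres of `a`, except where `c` vanishes, and the
sums of `c` over the fibres of `a` vanish off the fibre of `0`, which lies in `P`, then the part of
`c` in `P` has the same sum as the fibre of `0`. -/
theorem tsum_indicator_eq_of_fiber {ι : Type*} {X : Type*} [Zero X] [DecidableEq X] {c : ι → ℂ}
    (hc : Summable c) (a : ι → X) (P : Set ι) {w : ℂ}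
    (hfib : ∀ α, ∑' i, {i | a i = α}.indicator c i = if α = 0 then w else 0)
    (hP : ∀ i i', i ∈ P → a i' = a i → c i' = 0 ∨ i' ∈ P) (h0 : ∀ i, a i = 0 → i ∈ P) :
    ∑' i, P.indicator c i = w := by
  have hcP : Summable (P.indicator c) := hc.indicator P
  have h1 := hcP.hasSum.tsum_fiberwise a
  have h2 : ∀ α, ∑' i : a ⁻¹' {α}, P.indicator c i = if α = 0 then w else 0 := by
    intro α
    rw [tsum_subtype (a ⁻¹' {α}) (P.indicator c)]
    by_cases hex : α = 0 ∨ ∃ i ∈ P, a i = α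
    · rw [← hfib α]
      refine tsum_congr fun i => ?_
      by_cases hi : a i = α
      · rw [Set.indicator_of_mem (show i ∈ a ⁻¹' {α} from hi),
          Set.indicator_of_mem (show i ∈ {i | a i = α} from hi)]
        by_cases hiP : i ∈ P
        · rw [Set.indicator_of_mem hiP]
        · rw [Set.indicator_of_notMem hiP]
          rcases hex with rfl | ⟨i₀, hi₀, rfl⟩
          · exact absurd (h0 i hi) hiP
          · exact ((hP i₀ i hi₀ hi).resolve_right hiP).symm
      · rw [Set.indicator_of_notMem (show i ∉ a ⁻¹' {α} from hi),
          Set.indicator_of_notMem (show i ∉ {i | a i = α} from hi)]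
    · rw [not_or] at hex
      rw [if_neg hex.1]
      refine (tsum_congr fun i => ?_).trans tsum_zero
      by_cases hi : a i = α
      · rw [Set.indicator_of_mem (show i ∈ a ⁻¹' {α} from hi)]
        exact Set.indicator_of_notMem (fun hiP => hex.2 ⟨i, hiP, hi⟩) _
      · exact Set.indicator_of_notMem (show i ∉ a ⁻¹' {α} from hi) _
  simp only [h2] at h1
  have h3 := h1.tsum_eq
  rw [tsum_ite_eq] at h3
  exact h3.symm

theorem summable_corr_of_enorm {L : ℕ} {c : Fin L × ℤ × integerLattice n → ℂ}
    (h : ∀ l, ∑' j : ℤ, ∑' k : integerLattice n, ‖c (l, j, k)‖ₑ ≠ ∞) : Summable c := by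
  have h1 : ∑' p, ‖c p‖ₑ ≠ ∞ := by
    rw [ENNReal.tsum_prod', tsum_fintype]
    refine ENNReal.sum_ne_top.2 fun l _ => ?_
    rw [ENNReal.tsum_prod']
    exact h l
  refine Summable.of_nnnorm ?_
  rw [← ENNReal.tsum_coe_ne_top_iff_summable]
  exact h1

theorem corr_eq_zero_of_ae {f g φ ψ : L2 n} {k : E n}
    (h : ∀ᵐ ξ : E n, (𝓕 ψ : L2 n) ξ * (𝓕 φ : L2 n) (ξ + k) = 0) : corr f g φ ψ k = 0 := by
  refine integral_eq_zero_of_ae ?_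
  filter_upwards [h] with ξ hξ
  rcases mul_eq_zero.1 hξ with h0 | h0 <;> simp [h0]

/-- The lattice condition of the theorem, for frequencies `Bʲ k`: a frequency shared by two scales
that survives the oversampling at one of them survives it at the other, provided that
`k ∈ B^{J₀} ℤⁿ` there. -/
theorem mem_dualLattice_of_frequency_eq {A : GL (Fin n) ℝ} {Λ : Submodule ℤ (E n)} {J₀ : ℕ}
    (hcond : ∀ j : ℤ,
      transposePowImage A (J₀ + j) (integerLattice n) ∩ (dualLattice Λ : Set (E n)) ⊆
        transposePowImage A j (dualLattice Λ))
    {j j' : ℤ} {k k' : E n} (hk : k ∈ dualLattice Λ)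
    (hk' : k' ∈ transposePowImage A J₀ (integerLattice n))
    (h : glEquiv (glTranspose A ^ j') k' = glEquiv (glTranspose A ^ j) k) :
    k' ∈ dualLattice Λ := by
  have h1 : k = glEquiv (glTranspose A ^ (j' - j)) k' := by
    rw [← glEquiv_inv_apply_self (glTranspose A ^ j) k, ← h, ← glEquiv_mul_apply, ← zpow_neg,
      ← zpow_add]
    congr 3
    ring
  rw [transposePowImage_eq] at hk'
  obtain ⟨z, hz, rfl⟩ := hk'
  have h2 : k ∈ transposePowImage A (J₀ + (j' - j)) (integerLattice n) := by
    rw [transposePowImage_eq]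
    refine ⟨z, hz, ?_⟩
    rw [h1, ← glEquiv_mul_apply, ← zpow_add, add_comm]
  have h3 := hcond (j' - j) ⟨h2, hk⟩
  rw [transposePowImage_eq] at h3
  obtain ⟨μ, hμ, hμk⟩ := h3
  rw [h1] at hμk
  rwa [← (glEquiv _).injective hμk]

end

end WaveletOversampling

open WaveletOversampling in
theorem theorem4p6 (n L : ℕ) (A : GL (Fin n) ℝ) (hA : IsExpansive A)
    (Ψ Φ : Fin L → L2 n) (J₀ : ℕ)
    (Λ : Submodule ℤ (E n)) (hΛdisc : DiscreteTopology Λ) (hΛ : integerLattice n ≤ Λ)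
    (hcond : ∀ j : ℤ,
      transposePowImage A (J₀ + j) (integerLattice n) ∩ (dualLattice Λ : Set (E n)) ⊆
        transposePowImage A j (dualLattice Λ))
    (hsupp : ∀ l : Fin L, ∀ k ∈ integerLattice n,
      k ∉ transposePowImage A J₀ (integerLattice n) →
        ∀ᵐ ξ : E n, (𝓕 (Ψ l) : L2 n) ξ * (𝓕 (Φ l) : L2 n) (ξ + k) = 0)
    (hBesselΨ : IsBessel (oversampledSystem Ψ A Λ))
    (hBesselΦ : IsBessel (oversampledSystem Φ A Λ))
    (hdual : IsDualFrames (waveletSystem Ψ A (integerLattice n))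
      (waveletSystem Φ A (integerLattice n))) :
    IsDualFrames (oversampledSystem Ψ A Λ) (oversampledSystem Φ A Λ) := by
  classical
  rcases eq_or_ne n 0 with rfl | hn
  · -- in dimension `0` the two lattices coincide
    obtain rfl : Λ = integerLattice 0 := Subsingleton.elim _ _
    simpa only [oversampledSystem, covolume_integerLattice, Real.sqrt_one, Complex.ofReal_one,
      one_smul] using hdual
  obtain ⟨C, hC, hAC⟩ := hA.exists_bound
  refine ⟨hBesselΨ, hBesselΦ, hasSum_of_total hBesselΨ hBesselΦ
    (eq_zero_of_forall_inner_smallBandSet hn hC) fun f hf g hg => ?_⟩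
  -- the correlation coefficients, their frequencies, and the indices that survive oversampling
  set c : Fin L × ℤ × integerLattice n → ℂ := fun p =>
    corr (dilation (A ^ p.2.1)⁻¹ f) (dilation (A ^ p.2.1)⁻¹ g) (Φ p.1) (Ψ p.1) p.2.2 with hcdef
  set a : Fin L × ℤ × integerLattice n → E n := fun p =>
    glEquiv (glTranspose A ^ p.2.1) (p.2.2 : E n) with hadef
  set P : Set (Fin L × ℤ × integerLattice n) := {p | (p.2.2 : E n) ∈ dualLattice Λ} with hPdef
  have hsingle : ∀ {Θ : Fin L → L2 n}, IsBessel (waveletSystem Θ A (integerLattice n)) →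
      ∀ (l : Fin L) (h : L2 n), Summable fun p : ℤ × integerLattice n =>
        ‖⟪dilation (A ^ p.1) (translation (p.2 : E n) (Θ l)), h⟫_ℂ‖ ^ 2 := by
    rintro Θ ⟨K, hK⟩ l h
    exact (hK h).1.comp_injective (i := fun p => (l, p)) fun p q hpq => (Prod.ext_iff.1 hpq).2
  have hc : Summable c := summable_corr_of_enorm fun l =>
    tsum_tsum_enorm_corr_ne_top hA hC.le hAC (hsingle hdual.2.1 l) (hsingle hdual.1 l) hf hg
  have hband : ∀ {h : L2 n}, h ∈ smallBandSet n C → ∀ j : ℤ,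
      HasBoundedBand (dilation (A ^ j)⁻¹ h) := by
    rintro h ⟨x, r, M, -, -, hb⟩ j
    exact hb.hasBoundedBand_dilation_inv Metric.isBounded_closedBall _
  -- the frame expansion of the given systems, at every translate of `f` and `g`
  have hconst : ∀ x : E n, HasSum (fun i => ech (-⟪x, a i⟫_ℝ) * c i) ⟪g, f⟫_ℂ := by
    intro x
    have hsum : Summable fun i => ech (-⟪x, a i⟫_ℝ) * c i :=
      hc.norm.of_norm_bounded fun i => by rw [norm_mul, norm_ech, one_mul]
    have h1 := (hdual.2.2 (translation x f)).mapL (innerSL ℂ (translation x g))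
    simp only [innerSL_apply_apply, inner_smul_right] at h1
    rw [inner_translation_translation] at h1
    rw [hsum.hasSum_iff, ← h1.tsum_eq, h1.summable.tsum_prod, hsum.tsum_prod]
    refine tsum_congr fun l => ?_
    rw [(h1.summable.prod_factor l).tsum_prod, (hsum.prod_factor l).tsum_prod]
    refine tsum_congr fun j => ?_
    have h2 := hasSum_inner_mul_inner (hband hf j) (hband hg j) (Φ l) (Ψ l) (glEquiv (A ^ j) x)
    simp only [inner_glEquiv, glTranspose_zpow] at h2
    refine Eq.trans h2.tsum_eq.symm (tsum_congr fun γ => ?_)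
    rw [← inner_dilation_translation, ← inner_dilation_translation, inner_conj_symm]
    rfl
  have hfib := tsum_fiber_eq_of_hasSum_const hc hconst
  have hmain : ∑' i, P.indicator c i = ⟪g, f⟫_ℂ := by
    refine tsum_indicator_eq_of_fiber hc a P hfib ?_ ?_
    · rintro ⟨l, j, k⟩ ⟨l', j', k'⟩ hi ha
      by_cases hk' : (k' : E n) ∈ transposePowImage A J₀ (integerLattice n)
      · exact Or.inr (mem_dualLattice_of_frequency_eq hcond hi hk' ha)
      · exact Or.inl (corr_eq_zero_of_ae (hsupp l' k' k'.2 hk'))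
    · rintro ⟨l, j, k⟩ ha
      have h0 : (k : E n) = 0 := (map_eq_zero_iff _ (glEquiv _).injective).1 ha
      change (k : E n) ∈ dualLattice Λ
      rw [h0]
      exact zero_mem _
  have hs := hBesselΨ.summable_mul hBesselΦ f g
  have hcov : (ZLattice.covolume Λ : ℂ) * (integerSubgroup Λ).index = 1 := by
    exact_mod_cast covolume_mul_index hΛ
  have hcov0 : (ZLattice.covolume Λ : ℂ) ≠ 0 := left_ne_zero_of_mul_eq_one hcov
  have hsq : (Real.sqrt (ZLattice.covolume Λ) : ℂ) * (Real.sqrt (ZLattice.covolume Λ) : ℂ) =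
      (ZLattice.covolume Λ : ℂ) := by
    have := isZLattice_of_le hΛ
    rw [← Complex.ofReal_mul, Real.mul_self_sqrt (ZLattice.covolume_pos Λ volume).le]
  have hterm : ∀ l j (γ : Λ), ⟪oversampledSystem Φ A Λ (l, j, γ), f⟫_ℂ *
      starRingEnd ℂ ⟪oversampledSystem Ψ A Λ (l, j, γ), g⟫_ℂ = (ZLattice.covolume Λ : ℂ) *
        (⟪translation (γ : E n) (Φ l), dilation (A ^ j)⁻¹ f⟫_ℂ *
          starRingEnd ℂ ⟪translation (γ : E n) (Ψ l), dilation (A ^ j)⁻¹ g⟫_ℂ) := by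
    intro l j γ
    rw [inner_oversampledSystem, inner_oversampledSystem, map_mul, Complex.conj_ofReal, ← hsq]
    ring
  have hcP : Summable (P.indicator c) := hc.indicator P
  rw [hs.hasSum_iff, ← hmain, hs.tsum_prod, hcP.tsum_prod]
  refine tsum_congr fun l => ?_
  rw [(hs.prod_factor l).tsum_prod, (hcP.prod_factor l).tsum_prod]
  refine tsum_congr fun j => ?_
  have hsj := (hs.prod_factor l).prod_factor j
  simp only [hterm] at hsj ⊢
  rw [tsum_mul_left, tsum_inner_mul_inner_eq hΛ (hband hf j) (hband hg j)
    ((summable_mul_left_iff hcov0).1 hsj) ((hc.prod_factor l).prod_factor j), ← mul_assoc, hcov,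
    one_mul]
  refine tsum_congr fun k => ?_
  simp only [Set.indicator_apply, hPdef, hcdef, Set.mem_ofPred_eq]
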